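/- Fix a set $\{p_i : i\in I\}$ of atomic propositions. A \emph{relational inquisitive model} is a two-sorted structure $\mathfrak M=(W,S,E,\varepsilon,(P_i)_{i\in I})$ with $W,S$ non-empty, $E,\varepsilon\subseteq W\times S$, $P_i\subseteq W$, such that, writing $\underline s=\{w\in W: w\,\varepsilon\, s\}$: (i) $\underline s=\underline{s'}$ implies $s=s'$; (ii) every subset of $\underline s$ is of the form $\underline{s'}$ with $s'\in S$; (iii) $E[w]\neq\emptyset$ for all $w\in W$; (iv) $s\in E[w]$ and $\underline{s'}\subseteq\underline s$ imply $s'\in E[w]$. It is \emph{finite} if $W$ and $S$ are finite, and \emph{locally full} if for every $w\in W$ every subset of $\bigcup\{\underline s: s\in E[w]\}$ is of the form $\underline{t}$ with $t\in S$. It determines the inquisitive modal model $\mathfrak M^*$ with worlds $W$, $\Sigma(w)=\{\underline s: s\in E[w]\}$ and $V(p_i)=P_i$. Formulae of InqML, $\varphi::=p_i\mid\bot\mid\varphi\wedge\varphi\mid\varphi\to\varphi\mid\varphi\mathbin{\rotatebox[origin=c]{-90}{$\geqslant$}}\varphi\mid\square\varphi\mid\boxplus\varphi$, are evaluated at information states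 $s\subseteq W$: $s\models p_i$ iff $s\subseteq V(p_i)$; $s\models\bot$ iff $s=\emptyset$; $\wedge$ and $\mathbin{\rotatebox[origin=c]{-90}{$\geqslant$}}$ are interpreted as "and" and "or"; $s\models\varphi\to\psi$ iff every $t\subseteq s$ with $t\models\varphi$ satisfies $t\models\psi$; $s\models\square\varphi$ iff $\bigcup\Sigma(w)\models\varphi$ for all $w\in s$; $s\models\boxplus\varphi$ iff $t\models\varphi$ for all $w\in s$ and $t\in\Sigma(w)$. A formula is true at a world $w$ iff $\{w\}$ supports it. FO is two-sorted first-order logic with equality in the relations $E,\varepsilon,P_i$. A bisimulation between two such models $\mathfrak M,\mathfrak M'$ is a relation $Z\subseteq (W\times W')\cup(\wp(W)\times\wp(W'))$ such that: if $wZw'$, then $w,w'$ satisfy the same atoms, every $s\in\Sigma(w)$ is $Z$-related to some $s'\in\Sigma'(w')$, and vice versa; if $sZs'$, then every $w\in s$ is $Z$-related to some $w'\in s'$, and vice versa. Worlds are bisimilar ($\sim$) if some bisimulation relates them; information states $s,s'$ are bisimilar if every world of $s$ is bisimilar to some world of $s'$ and vice versa. \textbf{Theorem.} Let $\mathcal C$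 be one of the following classes of relational inquisitive models: all models; finite models; locally full models; finite locally full models. Then: (a) A property of world-pointed models $(\mathfrak M,w)$, $w\in W$, is definable over $\mathcal C$ by (truth of) an InqML-formula if and only if it is definable over $\mathcal C$ by an FO-formula $\varphi(\mathtt w)$ in a single free world variable and is $\sim$-invariant over $\mathcal C$. (b) A property of state-pointed models $(\mathfrak M,s)$, $s\in S$, is definable over $\mathcal C$ by (support of) an InqML-formula if and only if it is definable over $\mathcal C$ by an FO-formula $\varphi(\mathtt s)$ in a single free state variable, is satisfied by at least one state-pointed model in $\mathcal C$, is downward closed over $\mathcal C$ (if $\mathfrak M\in\mathcal C$, $(\mathfrak M,s)$ has the property and $\underline t\subseteq\underline s$, then $(\mathfrak M,t)$ has it), and is $\sim$-invariant over $\mathcal C$. -/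

import Mathlib

universe u v

namespace Inq

/-- Formulae of inquisitive modal logic over atomic propositions indexed by `I`.
`idisj` is inquisitive disjunction, `box` is `□`, `wbox` is `⊞`. -/
inductive Form (I : Type v) : Type v
  | atom : I → Form I
  | bot : Form I
  | and : Form I → Form I → Form I
  | imp : Form I → Form I → Form I
  | idisj : Form I → Form I → Form I
  | box : Form I → Form I
  | wbox : Form I → Form I

/-- Inquisitive modal models: each world is assigned an inquisitive state, i.e. a non-empty
downward closed set of information states. -/
structure Model (I : Type v) where
  W : Type u
  Sig : W → Set (Set W)
  sig_nonempty : ∀ w, (Sig w).Nonempty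
  sig_down : ∀ w s t, s ∈ Sig w → t ⊆ s → t ∈ Sig w
  V : I → Set W

namespace Model

variable {I : Type v}

/-- `σ(w) = ⋃ Σ(w)`. -/
def sigma (M : Model.{u, v} I) (w : M.W) : Set M.W := ⋃₀ M.Sig w

/-- Support of a formula at an information state. -/
def Supports (M : Model.{u, v} I) : Set M.W → Form I → Prop
  | s, .atom p => s ⊆ M.V p
  | s, .bot => s = ∅
  | s, .and φ ψ => M.Supports s φ ∧ M.Supports s ψ
  | s, .imp φ ψ => ∀ t, t ⊆ s → M.Supports t φ → M.Supports t ψ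
  | s, .idisj φ ψ => M.Supports s φ ∨ M.Supports s ψ
  | s, .box φ => ∀ w ∈ s, M.Supports (M.sigma w) φ
  | s, .wbox φ => ∀ w ∈ s, ∀ t ∈ M.Sig w, M.Supports t φ

/-- Truth of a formula at a world: support at the singleton state. -/
def Truth (M : Model.{u, v} I) (w : M.W) (φ : Form I) : Prop := M.Supports {w} φ

/-- Inquisitive bisimulations, given by their world part `ZW` and their state part `ZS`. -/
structure IsBisimulation (M N : Model.{u, v} I) (ZW : M.W → N.W → Prop)
    (ZS : Set M.W → Set N.W → Prop) : Prop where
  atoms : ∀ w w', ZW w w' → ∀ p, w ∈ M.V p ↔ w' ∈ N.V p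
  state_forth : ∀ s s', ZS s s' → ∀ w ∈ s, ∃ w' ∈ s', ZW w w'
  state_back : ∀ s s', ZS s s' → ∀ w' ∈ s', ∃ w ∈ s, ZW w w'
  world_forth : ∀ w w', ZW w w' → ∀ s ∈ M.Sig w, ∃ s' ∈ N.Sig w', ZS s s'
  world_back : ∀ w w', ZW w w' → ∀ s' ∈ N.Sig w', ∃ s ∈ M.Sig w, ZS s s'

/-- Bisimilarity of world-pointed models. -/
def WorldBisim (M : Model.{u, v} I) (w : M.W) (N : Model.{u, v} I) (w' : N.W) : Prop :=
  ∃ ZW ZS, IsBisimulation M N ZW ZS ∧ ZW w w'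

/-- Bisimilarity of state-pointed models. -/
def StateBisim (M : Model.{u, v} I) (s : Set M.W) (N : Model.{u, v} I) (s' : Set N.W) : Prop :=
  (∀ w ∈ s, ∃ w' ∈ s', WorldBisim M w N w') ∧ (∀ w' ∈ s', ∃ w ∈ s, WorldBisim M w N w')

end Model

/-- Relational inquisitive modal models: two-sorted structures `(W, S, E, ε, (P i))`. -/
structure RelModel (I : Type v) where
  W : Type u
  S : Type u
  E : W → S → Prop
  eps : W → S → Prop
  P : I → W → Prop
  nonempty_W : Nonempty W
  nonempty_S : Nonempty S
  extensionality : ∀ s s' : S, {w | eps w s} = {w | eps w s'} → s = s'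
  local_powerset : ∀ (s : S) (t : Set W), t ⊆ {w | eps w s} → ∃ s' : S, {w | eps w s'} = t
  nonemptiness : ∀ w, ∃ s, E w s
  downward_closure : ∀ w s s', E w s → {v | eps v s'} ⊆ {v | eps v s} → E w s'

namespace RelModel

variable {I : Type v}

/-- The set of worlds associated with an element of the second sort. -/
def ext (M : RelModel.{u, v} I) (s : M.S) : Set M.W := {w | M.eps w s}

/-- `R[w] = ⋃ E[w]`. -/
def R (M : RelModel.{u, v} I) (w : M.W) : Set M.W := {v | ∃ s, M.E w s ∧ M.eps v s}

/-- Local fullness: `℘(R[w]) ⊆ S` for all `w`. -/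
def LocallyFull (M : RelModel.{u, v} I) : Prop :=
  ∀ (w : M.W) (t : Set M.W), t ⊆ M.R w → ∃ s : M.S, M.ext s = t

/-- Finiteness of both sorts. -/
def IsFinite (M : RelModel.{u, v} I) : Prop := Finite M.W ∧ Finite M.S

/-- The inquisitive modal model `M*` determined by a relational model `M`. -/
def star (M : RelModel.{u, v} I) : Model.{u, v} I where
  W := M.W
  Sig w := {t | ∃ s, M.E w s ∧ M.ext s = t}
  sig_nonempty w := by
    obtain ⟨s, hs⟩ := M.nonemptiness w
    exact ⟨M.ext s, s, hs, rfl⟩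
  sig_down w s t := by
    rintro ⟨x, hx, rfl⟩ hts
    obtain ⟨y, hy⟩ := M.local_powerset x t hts
    refine ⟨y, M.downward_closure w x y hx ?_, hy⟩
    rw [hy]
    exact hts
  V p := {w | M.P p w}

end RelModel

/-- First-order formulae of the two-sorted relational language with equality, with free variables
among `m` variables for worlds and `n` variables for states. The quantifiers bind the last
variable of the respective sort. -/
inductive FO (I : Type v) : ℕ → ℕ → Type v
  | pred {m n : ℕ} : I → Fin m → FO I m n
  | relE {m n : ℕ} : Fin m → Fin n → FO I m n
  | relEps {m n : ℕ} : Fin m → Fin n → FO I m n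
  | eqW {m n : ℕ} : Fin m → Fin m → FO I m n
  | eqS {m n : ℕ} : Fin n → Fin n → FO I m n
  | falsum {m n : ℕ} : FO I m n
  | imp {m n : ℕ} : FO I m n → FO I m n → FO I m n
  | allW {m n : ℕ} : FO I (m + 1) n → FO I m n
  | allS {m n : ℕ} : FO I m (n + 1) → FO I m n

/-- Tarskian satisfaction in a relational model, under assignments of worlds and states. -/
def FO.Sat {I : Type v} (M : RelModel.{u, v} I) :
    {m n : ℕ} → FO I m n → (Fin m → M.W) → (Fin n → M.S) → Prop
  | _, _, .pred i x, a, _ => M.P i (a x)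
  | _, _, .relE x y, a, b => M.E (a x) (b y)
  | _, _, .relEps x y, a, b => M.eps (a x) (b y)
  | _, _, .eqW x y, a, _ => a x = a y
  | _, _, .eqS x y, _, b => b x = b y
  | _, _, .falsum, _, _ => False
  | _, _, .imp φ ψ, a, b => FO.Sat M φ a b → FO.Sat M ψ a b
  | _, _, .allW φ, a, b => ∀ w : M.W, FO.Sat M φ (Fin.snoc a w) b
  | _, _, .allS φ, a, b => ∀ s : M.S, FO.Sat M φ a (Fin.snoc b s)

/-- Names for the four classes of relational models. -/
inductive ModelClass
  | all
  | finite
  | locallyFull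
  | finiteLocallyFull

/-- Membership of a relational model in one of the four classes. -/
def ModelClass.Contains {I : Type v} : ModelClass → RelModel.{u, v} I → Prop
  | .all, _ => True
  | .finite, M => M.IsFinite
  | .locallyFull, M => M.LocallyFull
  | .finiteLocallyFull, M => M.IsFinite ∧ M.LocallyFull

/-- Properties of world-pointed relational models. -/
abbrev WorldProperty (I : Type v) : Type (max (u + 1) v) := (M : RelModel.{u, v} I) → M.W → Prop

/-- Properties of state-pointed relational models. -/
abbrev StateProperty (I : Type v) : Type (max (u + 1) v) := (M : RelModel.{u, v} I) → M.S → Prop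

namespace WorldProperty

variable {I : Type v}

def InqDefinable (C : ModelClass) (Q : WorldProperty.{u, v} I) : Prop :=
  ∃ φ : Form I, ∀ M : RelModel.{u, v} I, C.Contains M → ∀ w : M.W,
    Q M w ↔ M.star.Truth w φ

def FODefinable (C : ModelClass) (Q : WorldProperty.{u, v} I) : Prop :=
  ∃ φ : FO I 1 0, ∀ M : RelModel.{u, v} I, C.Contains M → ∀ w : M.W,
    Q M w ↔ φ.Sat M ![w] ![]

def BisimInvariant (C : ModelClass) (Q : WorldProperty.{u, v} I) : Prop :=
  ∀ M N : RelModel.{u, v} I, C.Contains M → C.Contains N → ∀ (w : M.W) (w' : N.W),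
    Model.WorldBisim M.star w N.star w' → (Q M w ↔ Q N w')

end WorldProperty

namespace StateProperty

variable {I : Type v}

def InqDefinable (C : ModelClass) (Q : StateProperty.{u, v} I) : Prop :=
  ∃ φ : Form I, ∀ M : RelModel.{u, v} I, C.Contains M → ∀ s : M.S,
    Q M s ↔ M.star.Supports (M.ext s) φ

def FODefinable (C : ModelClass) (Q : StateProperty.{u, v} I) : Prop :=
  ∃ φ : FO I 0 1, ∀ M : RelModel.{u, v} I, C.Contains M → ∀ s : M.S,
    Q M s ↔ φ.Sat M ![] ![s]

def BisimInvariant (C : ModelClass) (Q : StateProperty.{u, v} I) : Prop :=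
  ∀ M N : RelModel.{u, v} I, C.Contains M → C.Contains N → ∀ (s : M.S) (s' : N.S),
    Model.StateBisim M.star (M.ext s) N.star (N.ext s') → (Q M s ↔ Q N s')

def DownwardClosed (C : ModelClass) (Q : StateProperty.{u, v} I) : Prop :=
  ∀ M : RelModel.{u, v} I, C.Contains M → ∀ s t : M.S, M.ext t ⊆ M.ext s → Q M s → Q M t

/-- Some state-pointed model in the class has the property. -/
def NonemptyOver (C : ModelClass) (Q : StateProperty.{u, v} I) : Prop :=
  ∃ M : RelModel.{u, v} I, C.Contains M ∧ ∃ s : M.S, Q M s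

end StateProperty

end Inq

/-!
A state supports an inquisitive formula iff one of finitely many first-order formulae, the
resolutions of the formula, is true of all its worlds; this yields first-order definability.

Conversely, let a bisimulation invariant property be defined by a first-order formula of quantifier
rank `q`. Many disjoint copies of a model, each unravelled into more than `2 ^ q` layers, form a
model of the same class. In a looping copy the last layer leads back to itself, so every world is
bisimilar to the original one; in a truncated copy the last layer has trivial inquisitive states, so
a world in layer `0` is determined up to bisimilarity by the first few rounds of the bisimulation
game. Duplicator wins the Ehrenfeucht–Fraïssé game with `q` rounds between the initial layers of a
looping and of a truncated copy, by a locality argument in which fresh copies answer all moves far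
from the pebbles. Hence the property depends only on a bisimulation type of finite depth over
finitely many atoms. There are finitely many such types, and each of them is definable.
-/

namespace Inq

variable {I : Type v}

/-- The Egli–Milner lifting of a relation to sets: each element of one set is related to some
element of the other. Lifting bisimilarity of worlds gives bisimilarity of states. -/
def EgliMilner {α β : Type*} (Z : α → β → Prop) (s : Set α) (t : Set β) : Prop :=
  (∀ a ∈ s, ∃ b ∈ t, Z a b) ∧ ∀ b ∈ t, ∃ a ∈ s, Z a b

namespace EgliMilner

variable {α β γ : Type*} {Z : α → β → Prop} {s : Set α} {t : Set β}

theorem mono {Z' : α → β → Prop} (h : EgliMilner Z s t) (hZ : ∀ a b, Z a b → Z' a b) :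
    EgliMilner Z' s t :=
  ⟨fun a ha => (h.1 a ha).imp fun _ hb => ⟨hb.1, hZ _ _ hb.2⟩,
    fun b hb => (h.2 b hb).imp fun _ ha => ⟨ha.1, hZ _ _ ha.2⟩⟩

theorem flip (h : EgliMilner Z s t) : EgliMilner (flip Z) t s := ⟨h.2, h.1⟩

theorem comp {Z' : β → γ → Prop} {r : Set γ} (h : EgliMilner Z s t) (h' : EgliMilner Z' t r) :
    EgliMilner (Relation.Comp Z Z') s r := by
  constructor
  · intro a ha
    obtain ⟨b, hb, hab⟩ := h.1 a ha
    obtain ⟨c, hc, hbc⟩ := h'.1 b hb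
    exact ⟨c, hc, b, hab, hbc⟩
  · intro c hc
    obtain ⟨b, hb, hbc⟩ := h'.2 c hc
    obtain ⟨a, ha, hab⟩ := h.2 b hb
    exact ⟨a, ha, b, hab, hbc⟩

theorem exists_subset (h : EgliMilner Z s t) {r : Set α} (hr : r ⊆ s) :
    ∃ r' ⊆ t, EgliMilner Z r r' := by
  refine ⟨{b ∈ t | ∃ a ∈ r, Z a b}, Set.sep_subset _ _, fun a ha => ?_, fun b hb => hb.2⟩
  obtain ⟨b, hb, hab⟩ := h.1 a (hr ha)
  exact ⟨b, ⟨hb, a, ha, hab⟩, hab⟩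

theorem sUnion {S : Set (Set α)} {T : Set (Set β)} (h : EgliMilner (EgliMilner Z) S T) :
    EgliMilner Z (⋃₀ S) (⋃₀ T) := by
  constructor
  · rintro a ⟨s, hs, ha⟩
    obtain ⟨t, ht, hst⟩ := h.1 s hs
    obtain ⟨b, hb, hab⟩ := hst.1 a ha
    exact ⟨b, ⟨t, ht, hb⟩, hab⟩
  · rintro b ⟨t, ht, hb⟩
    obtain ⟨s, hs, hst⟩ := h.2 t ht
    obtain ⟨a, ha, hab⟩ := hst.2 b hb
    exact ⟨a, ⟨s, hs, ha⟩, hab⟩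

end EgliMilner

theorem egliMilner_singleton {α β : Type*} {Z : α → β → Prop} {a : α} {b : β} :
    EgliMilner Z {a} {b} ↔ Z a b := by
  simp only [EgliMilner, Set.mem_singleton_iff, forall_eq, exists_eq_left, and_self]

theorem egliMilner_eq {α : Type*} {s t : Set α} : EgliMilner Eq s t ↔ s = t := by
  simp only [EgliMilner, exists_eq_right', exists_eq_right, Set.Subset.antisymm_iff,
    Set.subset_def]

theorem egliMilner_image_image {α β γ δ : Type*} {Z : γ → δ → Prop} {f : α → γ} {g : β → δ}
    {s : Set α} {t : Set β} :
    EgliMilner Z (f '' s) (g '' t) ↔ EgliMilner (fun a b => Z (f a) (g b)) s t := by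
  simp only [EgliMilner, Set.forall_mem_image, Set.exists_mem_image]

theorem egliMilner_image_right {α β γ : Type*} {Z : α → γ → Prop} {g : β → γ}
    {s : Set α} {t : Set β} :
    EgliMilner Z s (g '' t) ↔ EgliMilner (fun a b => Z a (g b)) s t := by
  simp only [EgliMilner, Set.forall_mem_image, Set.exists_mem_image]

namespace Model

variable {M N K : Model.{u, v} I}

theorem empty_mem_Sig (M : Model.{u, v} I) (w : M.W) : ∅ ∈ M.Sig w :=
  let ⟨s, hs⟩ := M.sig_nonempty w
  M.sig_down w s ∅ hs (Set.empty_subset s)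

theorem supports_empty (M : Model.{u, v} I) (φ : Form I) : M.Supports ∅ φ := by
  induction φ with
  | atom p => exact Set.empty_subset _
  | bot => rfl
  | and φ ψ hφ hψ => exact ⟨hφ, hψ⟩
  | imp φ ψ _ hψ =>
    intro t ht _
    rwa [Set.subset_empty_iff.1 ht]
  | idisj φ ψ hφ _ => exact Or.inl hφ
  | box φ _ => exact fun w hw => hw.elim
  | wbox φ _ => exact fun w hw => hw.elim

theorem Supports.mono {φ : Form I} {s t : Set M.W} (h : M.Supports s φ) (hts : t ⊆ s) :
    M.Supports t φ := by
  induction φ with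
  | atom p => exact hts.trans h
  | bot => exact Set.subset_empty_iff.1 (hts.trans_eq h)
  | and φ ψ hφ hψ => exact ⟨hφ h.1, hψ h.2⟩
  | imp φ ψ _ _ => exact fun r hr => h r (hr.trans hts)
  | idisj φ ψ hφ hψ => exact h.imp hφ hψ
  | box φ _ => exact fun w hw => h w (hts hw)
  | wbox φ _ => exact fun w hw => h w (hts hw)

/-! ### Bisimilarity -/

theorem WorldBisim.of_relation {Z : M.W → N.W → Prop}
    (hV : ∀ w w', Z w w' → ∀ p, w ∈ M.V p ↔ w' ∈ N.V p)
    (hSig : ∀ w w', Z w w' → EgliMilner (EgliMilner Z) (M.Sig w) (N.Sig w'))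
    {w : M.W} {w' : N.W} (h : Z w w') : WorldBisim M w N w' :=
  ⟨Z, EgliMilner Z, ⟨hV, fun _ _ h => h.1, fun _ _ h => h.2, fun w w' h => (hSig w w' h).1,
    fun w w' h => (hSig w w' h).2⟩, h⟩

theorem WorldBisim.mem_V_iff {w : M.W} {w' : N.W} (h : WorldBisim M w N w') (p : I) :
    w ∈ M.V p ↔ w' ∈ N.V p := by
  obtain ⟨_, _, hB, hw⟩ := h
  exact hB.atoms w w' hw p

theorem WorldBisim.egliMilner_Sig {w : M.W} {w' : N.W} (h : WorldBisim M w N w') :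
    EgliMilner (EgliMilner fun v v' => WorldBisim M v N v') (M.Sig w) (N.Sig w') := by
  obtain ⟨ZW, ZS, hB, hw⟩ := h
  have hSig : EgliMilner ZS (M.Sig w) (N.Sig w') := ⟨hB.world_forth w w' hw, hB.world_back w w' hw⟩
  refine hSig.mono fun s s' hs => ?_
  have hst : EgliMilner ZW s s' := ⟨hB.state_forth s s' hs, hB.state_back s s' hs⟩
  exact hst.mono fun v v' hv => ⟨ZW, ZS, hB, hv⟩

theorem WorldBisim.symm {w : M.W} {w' : N.W} (h : WorldBisim M w N w') : WorldBisim N w' M w :=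
  of_relation (Z := fun v' v => WorldBisim M v N v') (fun _ _ h p => (h.mem_V_iff p).symm)
    (fun _ _ h => h.egliMilner_Sig.flip.mono fun _ _ hs => hs.flip) h

theorem WorldBisim.trans {w : M.W} {w' : N.W} {w'' : K.W} (h : WorldBisim M w N w')
    (h' : WorldBisim N w' K w'') : WorldBisim M w K w'' := by
  refine of_relation
    (Z := Relation.Comp (fun v v' => WorldBisim M v N v') fun v' v'' => WorldBisim N v' K v'')
    ?_ ?_ ⟨w', h, h'⟩
  · rintro v v'' ⟨v', hv, hv'⟩ p
    exact (hv.mem_V_iff p).trans (hv'.mem_V_iff p)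
  · rintro v v'' ⟨v', hv, hv'⟩
    refine (hv.egliMilner_Sig.comp hv'.egliMilner_Sig).mono ?_
    rintro s s'' ⟨s', hs, hs'⟩
    exact hs.comp hs'

theorem StateBisim.symm {s : Set M.W} {s' : Set N.W} (h : StateBisim M s N s') :
    StateBisim N s' M s :=
  (EgliMilner.flip h).mono fun _ _ h => h.symm

theorem StateBisim.trans {s : Set M.W} {s' : Set N.W} {s'' : Set K.W} (h : StateBisim M s N s')
    (h' : StateBisim N s' K s'') : StateBisim M s K s'' :=
  (EgliMilner.comp h h').mono fun _ _ ⟨_, hv, hv'⟩ => hv.trans hv'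

theorem WorldBisim.sigma {w : M.W} {w' : N.W} (h : WorldBisim M w N w') :
    StateBisim M (M.sigma w) N (N.sigma w') :=
  h.egliMilner_Sig.sUnion

theorem Supports.of_stateBisim {φ : Form I} {s : Set M.W} {s' : Set N.W} (hs : M.Supports s φ)
    (h : StateBisim M s N s') : N.Supports s' φ := by
  induction φ generalizing M N s s' with
  | atom p =>
    intro w' hw'
    obtain ⟨w, hw, hww'⟩ := h.2 w' hw'
    exact (hww'.mem_V_iff p).1 (hs hw)
  | bot =>
    refine Set.eq_empty_of_forall_notMem fun w' hw' => ?_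
    obtain ⟨w, hw, -⟩ := h.2 w' hw'
    exact (Set.eq_empty_iff_forall_notMem.1 hs) w hw
  | and φ ψ hφ hψ => exact ⟨hφ hs.1 h, hψ hs.2 h⟩
  | imp φ ψ hφ hψ =>
    intro t' ht' ht'φ
    obtain ⟨t, ht, htt'⟩ := EgliMilner.exists_subset h.symm ht'
    exact hψ (hs t ht (hφ ht'φ htt')) (StateBisim.symm htt')
  | idisj φ ψ hφ hψ => exact hs.imp (hφ · h) (hψ · h)
  | box φ hφ =>
    intro w' hw'
    obtain ⟨w, hw, hww'⟩ := h.2 w' hw'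
    exact hφ (hs w hw) hww'.sigma
  | wbox φ hφ =>
    intro w' hw' t' ht'
    obtain ⟨w, hw, hww'⟩ := h.2 w' hw'
    obtain ⟨t, ht, htt'⟩ := hww'.egliMilner_Sig.2 t' ht'
    exact hφ (hs w hw t ht) htt'

theorem StateBisim.supports_iff {s : Set M.W} {s' : Set N.W} (h : StateBisim M s N s')
    (φ : Form I) : M.Supports s φ ↔ N.Supports s' φ :=
  ⟨fun hs => hs.of_stateBisim h, fun hs' => hs'.of_stateBisim h.symm⟩

theorem WorldBisim.truth_iff {w : M.W} {w' : N.W} (h : WorldBisim M w N w') (φ : Form I) :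
    M.Truth w φ ↔ N.Truth w' φ :=
  StateBisim.supports_iff (egliMilner_singleton.2 h) φ

end Model

/-! ### Definability in inquisitive modal logic -/

namespace Form

/-- Negation `φ → ⊥`, supported by the states at whose worlds `φ` fails. -/
def neg (φ : Form I) : Form I := .imp φ .bot

/-- Inquisitive disjunction of a list of formulae. -/
def disj : List (Form I) → Form I
  | [] => .bot
  | φ :: l => .idisj φ (disj l)

variable (M : Model.{u, v} I) (s : Set M.W) (w : M.W) (φ : Form I)

theorem supports_neg : M.Supports s φ.neg ↔ ∀ w ∈ s, ¬ M.Truth w φ := by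
  constructor
  · intro h w hw hφ
    exact Set.singleton_ne_empty w (h {w} (Set.singleton_subset_iff.2 hw) hφ)
  · intro h t ht hφ
    refine Set.eq_empty_of_forall_notMem fun w hw => h w (ht hw) ?_
    exact Model.Supports.mono hφ (Set.singleton_subset_iff.2 hw)

theorem truth_neg : M.Truth w φ.neg ↔ ¬ M.Truth w φ := by
  rw [Model.Truth, supports_neg]
  exact forall_eq

theorem supports_neg_neg : M.Supports s φ.neg.neg ↔ ∀ w ∈ s, M.Truth w φ := by
  simp only [supports_neg, truth_neg, not_not]

theorem truth_wbox : M.Truth w φ.wbox ↔ ∀ t ∈ M.Sig w, M.Supports t φ :=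
  forall_eq

theorem supports_disj (l : List (Form I)) :
    M.Supports s (disj l) ↔ s = ∅ ∨ ∃ φ ∈ l, M.Supports s φ := by
  induction l with
  | nil => simp [disj, Model.Supports]
  | cons φ l ih =>
    simp only [disj, Model.Supports, ih, List.exists_mem_cons_iff]
    exact or_left_comm

end Form

/-- A property of world-pointed inquisitive models is defined by the truth of some formula. -/
def TruthDefinable (A : (M : Model.{u, v} I) → M.W → Prop) : Prop :=
  ∃ φ : Form I, ∀ M w, M.Truth w φ ↔ A M w

/-- A property of state-pointed inquisitive models is defined by the support of some formula. -/
def SupportDefinable (A : (M : Model.{u, v} I) → Set M.W → Prop) : Prop :=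
  ∃ φ : Form I, ∀ M s, M.Supports s φ ↔ A M s

namespace SupportDefinable

theorem congr {A B : (M : Model.{u, v} I) → Set M.W → Prop} (hA : SupportDefinable A)
    (h : ∀ M s, A M s ↔ B M s) : SupportDefinable B :=
  hA.imp fun _ hφ M s => (hφ M s).trans (h M s)

theorem exists_finite {ι : Type*} [Finite ι] [Nonempty ι]
    {A : ι → (M : Model.{u, v} I) → Set M.W → Prop} (h : ∀ i, SupportDefinable (A i)) :
    SupportDefinable fun M s => ∃ i, A i M s := by
  choose φ hφ using h
  have := Fintype.ofFinite ι
  refine ⟨Form.disj (Finset.univ.toList.map φ), fun M s => ?_⟩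
  simp only [Form.supports_disj, List.mem_map, Finset.mem_toList, Finset.mem_univ,
    true_and, exists_exists_eq_and, hφ, or_iff_right_iff_imp]
  rintro rfl
  have i := Classical.arbitrary ι
  exact ⟨i, (hφ i M ∅).1 (M.supports_empty _)⟩

theorem wbox {A : (M : Model.{u, v} I) → Set M.W → Prop} (hA : SupportDefinable A) :
    TruthDefinable fun M w => ∀ t ∈ M.Sig w, A M t := by
  obtain ⟨φ, hφ⟩ := hA
  exact ⟨φ.wbox, fun M w => by simp only [Form.truth_wbox, hφ]⟩

end SupportDefinable

namespace TruthDefinable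

variable {A B : (M : Model.{u, v} I) → M.W → Prop}

theorem congr (hA : TruthDefinable A) (h : ∀ M w, A M w ↔ B M w) : TruthDefinable B :=
  hA.imp fun _ hφ M w => (hφ M w).trans (h M w)

theorem not (hA : TruthDefinable A) : TruthDefinable fun M w => ¬ A M w := by
  obtain ⟨φ, hφ⟩ := hA
  exact ⟨φ.neg, fun M w => by rw [Form.truth_neg, hφ]⟩

theorem and (hA : TruthDefinable A) (hB : TruthDefinable B) :
    TruthDefinable fun M w => A M w ∧ B M w := by
  obtain ⟨φ, hφ⟩ := hA
  obtain ⟨ψ, hψ⟩ := hB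
  exact ⟨φ.and ψ, fun M w => and_congr (hφ M w) (hψ M w)⟩

theorem iff_const (hA : TruthDefinable A) (c : Prop) :
    TruthDefinable fun M w => (A M w ↔ c) := by
  by_cases hc : c
  · simpa only [hc, iff_true] using hA
  · simpa only [hc, iff_false] using hA.not

theorem exists_finite {ι : Type*} [Finite ι] {A : ι → (M : Model.{u, v} I) → M.W → Prop}
    (h : ∀ i, TruthDefinable (A i)) : TruthDefinable fun M w => ∃ i, A i M w := by
  choose φ hφ using h
  have := Fintype.ofFinite ι
  refine ⟨Form.disj (Finset.univ.toList.map φ), fun M w => ?_⟩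
  simp only [← hφ, Model.Truth, Form.supports_disj, Set.singleton_ne_empty, false_or,
    List.mem_map, Finset.mem_toList, Finset.mem_univ, true_and, exists_exists_eq_and]

theorem forall_finite {ι : Type*} [Finite ι] {A : ι → (M : Model.{u, v} I) → M.W → Prop}
    (h : ∀ i, TruthDefinable (A i)) : TruthDefinable fun M w => ∀ i, A i M w :=
  (exists_finite fun i => (h i).not).not.congr fun _ _ => not_exists_not

theorem supportDefinable (hA : TruthDefinable A) : SupportDefinable fun M s => ∀ w ∈ s, A M w := by
  obtain ⟨φ, hφ⟩ := hA
  exact ⟨φ.neg.neg, fun M s => by simp only [Form.supports_neg_neg, hφ]⟩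

end TruthDefinable

/-! ### Finite bisimulation types -/

/-- The possible types of worlds up to `n` rounds of the bisimulation game over the atoms in
`J`: the atoms of a world together with the sets of lower types realised by its states. -/
def BisimType (J : Set I) : ℕ → Type v
  | 0 => Set J
  | n + 1 => Set J × Set (Set (BisimType J n))

theorem BisimType.finite {J : Set I} (hJ : J.Finite) (n : ℕ) : Finite (BisimType J n) := by
  have := hJ.to_subtype
  induction n with
  | zero => exact inferInstanceAs (Finite (Set J))
  | succ n ih => exact inferInstanceAs (Finite (Set J × Set (Set (BisimType J n))))

namespace Model

/-- The atoms in `J` that hold at a world. -/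
def atomsAt (M : Model.{u, v} I) (J : Set I) (w : M.W) : Set J := {p | w ∈ M.V p}

/-- The type of a world up to `n` rounds of the bisimulation game over the atoms in `J`. -/
def bisimType (M : Model.{u, v} I) (J : Set I) : (n : ℕ) → M.W → BisimType J n
  | 0, w => M.atomsAt J w
  | n + 1, w => (M.atomsAt J w, (M.bisimType J n '' ·) '' M.Sig w)

variable {M N : Model.{u, v} I} {J : Set I} {n : ℕ} {w : M.W} {w' : N.W}

theorem atomsAt_eq_of_bisimType_eq (h : M.bisimType J n w = N.bisimType J n w') :
    M.atomsAt J w = N.atomsAt J w' := by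
  cases n with
  | zero => exact h
  | succ n => exact congrArg Prod.fst h

theorem egliMilner_Sig_of_bisimType_succ_eq
    (h : M.bisimType J (n + 1) w = N.bisimType J (n + 1) w') :
    EgliMilner (EgliMilner fun v v' => M.bisimType J n v = N.bisimType J n v')
      (M.Sig w) (N.Sig w') := by
  have hSig := egliMilner_eq.2 (congrArg Prod.snd h)
  refine (egliMilner_image_image.1 hSig).mono fun s s' hs => ?_
  exact egliMilner_image_image.1 (egliMilner_eq.2 hs)

theorem exists_mem_Sig_image_eq_iff (M : Model.{u, v} I) (w : M.W) {α : Type*} (f : M.W → α)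
    (X : Set α) : (∃ s ∈ M.Sig w, f '' s = X) ↔ ∃ s ∈ M.Sig w, X ⊆ f '' s := by
  constructor
  · rintro ⟨s, hs, rfl⟩
    exact ⟨s, hs, subset_rfl⟩
  · rintro ⟨s, hs, hX⟩
    obtain ⟨t, hts, rfl⟩ := Set.subset_image_iff.1 hX
    exact ⟨t, M.sig_down w s t hs hts, rfl⟩

end Model

namespace TruthDefinable

variable {J : Set I} {n : ℕ}

theorem mem_V (p : I) : TruthDefinable fun (M : Model.{u, v} I) w => w ∈ M.V p :=
  ⟨.atom p, fun _ _ => Set.singleton_subset_iff⟩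

theorem atomsAt_eq (hJ : J.Finite) (a : Set J) :
    TruthDefinable fun (M : Model.{u, v} I) w => M.atomsAt J w = a := by
  have := hJ.to_subtype
  exact (forall_finite fun p : J => (mem_V (p : I)).iff_const (p ∈ a)).congr
    fun _ _ => Set.ext_iff.symm

theorem mem_image_Sig
    (h : ∀ τ : BisimType J n, TruthDefinable fun (M : Model.{u, v} I) w => M.bisimType J n w = τ)
    (hJ : J.Finite) (X : Set (BisimType J n)) :
    TruthDefinable fun (M : Model.{u, v} I) w => X ∈ (M.bisimType J n '' ·) '' M.Sig w := by
  simp only [Set.mem_image, Model.exists_mem_Sig_image_eq_iff]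
  rcases X.eq_empty_or_nonempty with rfl | hX
  · refine ⟨Form.neg .bot, fun M w => iff_of_true (fun _ _ => id) ?_⟩
    exact ⟨∅, M.empty_mem_Sig w, Set.empty_subset _⟩
  · have := BisimType.finite hJ n
    have := hX.to_subtype
    have hmissed : TruthDefinable fun (M : Model.{u, v} I) w =>
        ∀ s ∈ M.Sig w, ∃ τ : X, ∀ v ∈ s, M.bisimType J n v ≠ τ :=
      (SupportDefinable.exists_finite fun τ : X => (h τ).not.supportDefinable).wbox
    refine hmissed.not.congr fun M w => ?_
    simp only [Set.subset_def, Set.mem_image, Subtype.exists, not_forall, not_exists, not_and,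
      ne_eq, not_not, exists_prop]

theorem bisimType_eq (hJ : J.Finite) (n : ℕ) (τ : BisimType J n) :
    TruthDefinable fun (M : Model.{u, v} I) w => M.bisimType J n w = τ := by
  induction n with
  | zero => exact atomsAt_eq hJ τ
  | succ n ih =>
    have := BisimType.finite hJ n
    obtain ⟨a, F⟩ : Set J × Set (Set (BisimType J n)) := τ
    refine ((atomsAt_eq hJ a).and (forall_finite fun X =>
      (mem_image_Sig ih hJ X).iff_const (X ∈ F))).congr fun M w => ?_
    exact (and_congr_right' Set.ext_iff.symm).trans Prod.mk_inj.symm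

theorem bisimType_mem (hJ : J.Finite) (X : Set (BisimType J n)) :
    TruthDefinable fun (M : Model.{u, v} I) w => M.bisimType J n w ∈ X := by
  have := BisimType.finite hJ n
  exact (exists_finite fun τ : X => bisimType_eq hJ n τ).congr fun M w => by
    simp only [Subtype.exists, exists_prop, exists_eq_right']

end TruthDefinable

theorem SupportDefinable.exists_image_bisimType_subset {J : Set I} (hJ : J.Finite) {n : ℕ}
    {F : Set (Set (BisimType J n))} (hF : F.Nonempty) :
    SupportDefinable fun (M : Model.{u, v} I) s => ∃ X ∈ F, M.bisimType J n '' s ⊆ X := by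
  have := BisimType.finite hJ n
  have := hF.to_subtype
  refine (exists_finite fun X : F =>
    (TruthDefinable.bisimType_mem hJ (X : Set (BisimType J n))).supportDefinable).congr ?_
  simp only [Set.subset_def, Set.forall_mem_image, Subtype.exists, exists_prop, implies_true]

/-! ### Resolutions and first-order definability -/

namespace FO

variable {m n : ℕ}

/-- Negation `φ → ⊥`. -/
def neg (φ : FO I m n) : FO I m n := φ.imp .falsum

/-- Conjunction of a list of formulae, expressed by means of implication and falsum. -/
def conj : List (FO I m n) → FO I m n
  | [] => neg .falsum
  | φ :: l => (φ.imp (conj l).neg).neg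

/-- Disjunction of a list of formulae. -/
def disj : List (FO I m n) → FO I m n
  | [] => .falsum
  | φ :: l => φ.neg.imp (disj l)

variable (M : RelModel.{u, v} I) (a : Fin m → M.W) (b : Fin n → M.S)

theorem sat_conj (l : List (FO I m n)) : (conj l).Sat M a b ↔ ∀ φ ∈ l, φ.Sat M a b := by
  induction l with
  | nil => simp [conj, neg, Sat]
  | cons φ l ih => simp only [conj, neg, Sat, ih, List.forall_mem_cons, imp_false,
      Classical.not_imp, not_not]

theorem sat_disj (l : List (FO I m n)) : (disj l).Sat M a b ↔ ∃ φ ∈ l, φ.Sat M a b := by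
  induction l with
  | nil => simp [disj, Sat]
  | cons φ l ih => simp only [disj, neg, Sat, ih, List.exists_mem_cons_iff, imp_false,
      or_iff_not_imp_left]

variable {M a b}

/-- The formula `α`, whose last world variable is distinguished, is true of all worlds in `s`. -/
def HoldsOn (M : RelModel.{u, v} I) (a : Fin m → M.W) (b : Fin n → M.S) (s : Set M.W)
    (α : FO I (m + 1) n) : Prop :=
  ∀ w ∈ s, α.Sat M (Fin.snoc a w) b

/-- The conjunctions obtained by choosing one formula from each list: the disjunctive form of a
conjunction of inquisitive disjunctions. -/
def distrib (Ls : List (List (FO I m n))) : List (FO I m n) := Ls.sections.map conj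

theorem exists_mem_distrib {s : Set M.W} {Ls : List (List (FO I (m + 1) n))} :
    (∃ γ ∈ distrib Ls, HoldsOn M a b s γ) ↔ ∀ L ∈ Ls, ∃ α ∈ L, HoldsOn M a b s α := by
  have hconj : ∀ l : List (FO I (m + 1) n),
      HoldsOn M a b s (conj l) ↔ ∀ α ∈ l, HoldsOn M a b s α := fun l => by
    simp only [HoldsOn, sat_conj]
    exact ⟨fun h α hα w hw => h w hw α hα, fun h w hw α hα => h α hα w hw⟩
  simp only [distrib, List.mem_map, exists_exists_and_eq_and, hconj, List.mem_sections]
  induction Ls with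
  | nil => simp
  | cons L Ls ih =>
    simp only [List.forall₂_cons_right_iff, List.forall_mem_cons, ← ih]
    constructor
    · rintro ⟨_, ⟨α, l, hα, hl, rfl⟩, h⟩
      rw [List.forall_mem_cons] at h
      exact ⟨⟨α, hα, h.1⟩, l, hl, h.2⟩
    · rintro ⟨⟨α, hα, h⟩, l, hl, h'⟩
      exact ⟨α :: l, ⟨α, l, hα, hl, rfl⟩, List.forall_mem_cons.2 ⟨h, h'⟩⟩

/-- `α` is true of all worlds belonging to the last state. -/
def onLastState (α : FO I (m + 1) (n + 1)) : FO I m (n + 1) :=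
  .allW ((relEps (Fin.last m) (Fin.last n)).imp α)

theorem sat_onLastState {α : FO I (m + 1) (n + 1)} {b : Fin (n + 1) → M.S} :
    α.onLastState.Sat M a b ↔ HoldsOn M a b (M.ext (b (Fin.last n))) α := by
  simp only [onLastState, Sat, Fin.snoc_last]
  rfl

/-- Each state `E`-related to the last world has a formula of `L` true of all its worlds. -/
def forallStates (L : List (FO I (m + 2) (n + 1))) : FO I (m + 1) n :=
  .allS ((relE (Fin.last m) (Fin.last n)).imp (disj (L.map onLastState)))

theorem sat_forallStates {L : List (FO I (m + 2) (n + 1))} {w : M.W} :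
    (forallStates L).Sat M (Fin.snoc a w) b ↔
      ∀ s, M.E w s → ∃ α ∈ L, HoldsOn M (Fin.snoc a w) (Fin.snoc b s) (M.ext s) α := by
  simp only [forallStates, Sat, Fin.snoc_last, sat_disj, List.mem_map, exists_exists_and_eq_and,
    sat_onLastState]

/-- `α` is true of all worlds in `R[w]`, for `w` the last world. -/
def onR (α : FO I (m + 2) n) : FO I (m + 1) n :=
  .allW (.imp (neg (.allS ((relE (Fin.last m).castSucc (Fin.last n)).imp
    (neg (relEps (Fin.last (m + 1)) (Fin.last n)))))) α)

theorem sat_onR {α : FO I (m + 2) n} {w : M.W} :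
    α.onR.Sat M (Fin.snoc a w) b ↔ HoldsOn M (Fin.snoc a w) b (M.R w) α := by
  simp only [onR, neg, Sat, Fin.snoc_last, Fin.snoc_castSucc, HoldsOn, RelModel.R,
    Set.mem_ofPred_eq, imp_false, not_forall, not_not, exists_prop]

end FO

/-- The resolutions of an inquisitive formula, as first-order formulae about the last world
variable: a state supports `φ` iff one of the resolutions is true of all its worlds. The
other variables are not mentioned; they let modalities extend the context without renaming. -/
def Form.resolutions : Form I → (m n : ℕ) → List (FO I (m + 1) n)
  | .atom p, m, _ => [.pred p (Fin.last m)]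
  | .bot, _, _ => [.falsum]
  | .and φ ψ, m, n => FO.distrib [φ.resolutions m n, ψ.resolutions m n]
  | .imp φ ψ, m, n =>
    FO.distrib ((φ.resolutions m n).map fun α => (ψ.resolutions m n).map α.imp)
  | .idisj φ ψ, m, n => φ.resolutions m n ++ ψ.resolutions m n
  | .box φ, m, n => [.disj ((φ.resolutions (m + 1) n).map FO.onR)]
  | .wbox φ, m, n => [.forallStates (φ.resolutions (m + 1) (n + 1))]

theorem RelModel.sigma_star (M : RelModel.{u, v} I) (w : M.W) : M.star.sigma w = M.R w := by
  ext x
  constructor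
  · rintro ⟨_, ⟨s, hs, rfl⟩, hx⟩
    exact ⟨s, hs, hx⟩
  · rintro ⟨s, hs, hx⟩
    exact ⟨M.ext s, ⟨s, hs, rfl⟩, hx⟩

theorem RelModel.supports_box {M : RelModel.{u, v} I} {s : Set M.W} {φ : Form I} :
    M.star.Supports s φ.box ↔ ∀ w ∈ s, M.star.Supports (M.R w) φ :=
  forall₂_congr fun w _ => iff_of_eq (congrArg (M.star.Supports · φ) (M.sigma_star w))

theorem RelModel.supports_wbox {M : RelModel.{u, v} I} {s : Set M.W} {φ : Form I} :
    M.star.Supports s φ.wbox ↔ ∀ w ∈ s, ∀ t, M.E w t → M.star.Supports (M.ext t) φ :=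
  forall₂_congr fun _ _ => ⟨fun h t ht => h _ ⟨t, ht, rfl⟩,
    fun h _ ⟨t, ht, hts⟩ => hts ▸ h t ht⟩

theorem supports_iff_exists_resolution {M : RelModel.{u, v} I} (φ : Form I) {m n : ℕ}
    (a : Fin m → M.W) (b : Fin n → M.S) (s : Set M.W) :
    M.star.Supports s φ ↔ ∃ α ∈ φ.resolutions m n, FO.HoldsOn M a b s α := by
  induction φ generalizing m n s with
  | atom p =>
    simp only [Form.resolutions, List.mem_singleton, exists_eq_left, FO.HoldsOn, FO.Sat,
      Fin.snoc_last]
    rfl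
  | bot =>
    simp only [Form.resolutions, List.mem_singleton, exists_eq_left]
    exact Set.eq_empty_iff_forall_notMem
  | and φ ψ hφ hψ =>
    simp only [Form.resolutions, Model.Supports, FO.exists_mem_distrib, hφ a b, hψ a b]
    rw [List.forall_mem_cons, List.forall_mem_singleton]
  | imp φ ψ hφ hψ =>
    simp only [Form.resolutions, FO.exists_mem_distrib, List.mem_map, forall_exists_index,
      and_imp, forall_apply_eq_imp_iff₂, exists_exists_and_eq_and]
    constructor
    · intro h α hα
      have hsep : M.star.Supports {w ∈ s | α.Sat M (Fin.snoc a w) b} φ :=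
        (hφ a b _).2 ⟨α, hα, fun w hw => hw.2⟩
      obtain ⟨β, hβ, hs⟩ := (hψ a b _).1 (h _ (Set.sep_subset _ _) hsep)
      exact ⟨β, hβ, fun w hw hwα => hs w ⟨hw, hwα⟩⟩
    · intro h t ht htφ
      obtain ⟨α, hα, htα⟩ := (hφ a b t).1 htφ
      obtain ⟨β, hβ, hs⟩ := h α hα
      exact (hψ a b t).2 ⟨β, hβ, fun w hw => hs w (ht hw) (htα w hw)⟩
  | idisj φ ψ hφ hψ =>
    simp only [Form.resolutions, Model.Supports, hφ a b, hψ a b, List.mem_append, or_and_right,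
      exists_or]
  | box φ hφ =>
    simp only [Form.resolutions, RelModel.supports_box, List.mem_singleton, exists_eq_left,
      FO.HoldsOn, FO.sat_disj, List.mem_map, exists_exists_and_eq_and, FO.sat_onR]
    exact forall₂_congr fun w _ => hφ (Fin.snoc a w) b _
  | wbox φ hφ =>
    simp only [Form.resolutions, RelModel.supports_wbox, List.mem_singleton, exists_eq_left,
      FO.HoldsOn, FO.sat_forallStates]
    exact forall₂_congr fun w _ => forall₂_congr fun t _ => hφ (Fin.snoc a w) (Fin.snoc b t) _

theorem WorldProperty.InqDefinable.foDefinable {C : ModelClass} {Q : WorldProperty.{u, v} I}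
    (h : Q.InqDefinable C) : Q.FODefinable C := by
  obtain ⟨φ, hφ⟩ := h
  refine ⟨.disj (φ.resolutions 0 0), fun M hM w => ?_⟩
  have hw : (Fin.snoc ![] w : Fin 1 → M.W) = ![w] := funext fun x => by
    rw [Fin.fin_one_eq_zero x]; rfl
  refine (hφ M hM w).trans ((supports_iff_exists_resolution φ ![] ![] {w}).trans ?_)
  simp only [FO.HoldsOn, Set.mem_singleton_iff, forall_eq, FO.sat_disj, hw]

theorem StateProperty.InqDefinable.foDefinable {C : ModelClass} {Q : StateProperty.{u, v} I}
    (h : Q.InqDefinable C) : Q.FODefinable C := by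
  obtain ⟨φ, hφ⟩ := h
  refine ⟨.disj ((φ.resolutions 0 1).map FO.onLastState), fun M hM s => ?_⟩
  rw [hφ M hM s, FO.sat_disj, supports_iff_exists_resolution φ ![] ![s]]
  simp only [List.mem_map, exists_exists_and_eq_and, FO.sat_onLastState]
  rfl

/-! ### Constructions of relational models -/

theorem ModelClass.Contains.of_imp {C : ModelClass} {M N : RelModel.{u, v} I}
    (h : C.Contains M) (hfin : M.IsFinite → N.IsFinite)
    (hfull : M.LocallyFull → N.LocallyFull) : C.Contains N := by
  cases C with
  | all => trivial
  | finite => exact hfin h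
  | locallyFull => exact hfull h
  | finiteLocallyFull => exact ⟨hfin h.1, hfull h.2⟩

/-- The restriction of the valuation to the atoms in `J`: all other atoms become false. -/
def Model.restrict (M : Model.{u, v} I) (J : Set I) : Model.{u, v} I :=
  { M with V := fun p => {w | p ∈ J ∧ w ∈ M.V p} }

namespace RelModel

/-- The relational model over an inquisitive model whose second sort is a given downward closed
family `𝒮` of information states. -/
def ofModel (M : Model.{u, v} I) (hW : Nonempty M.W) (𝒮 : Set (Set M.W)) (h𝒮 : IsLowerSet 𝒮)
    (hSig : ∀ w, M.Sig w ⊆ 𝒮) : RelModel.{u, v} I where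
  W := M.W
  S := 𝒮
  E w s := s.1 ∈ M.Sig w
  eps w s := w ∈ s.1
  P p w := w ∈ M.V p
  nonempty_W := hW
  nonempty_S :=
    let ⟨w⟩ := hW
    ⟨⟨∅, hSig w (M.empty_mem_Sig w)⟩⟩
  extensionality _ _ h := Subtype.ext h
  local_powerset s t ht := ⟨⟨t, h𝒮 ht s.2⟩, rfl⟩
  nonemptiness w := ⟨⟨∅, hSig w (M.empty_mem_Sig w)⟩, M.empty_mem_Sig w⟩
  downward_closure w s s' hs hs' := M.sig_down w s.1 s'.1 hs hs'

section ofModel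

variable {M : Model.{u, v} I} {hW : Nonempty M.W} {𝒮 : Set (Set M.W)} {h𝒮 : IsLowerSet 𝒮}
  {hSig : ∀ w, M.Sig w ⊆ 𝒮}

theorem Sig_star_ofModel (w : M.W) : (ofModel M hW 𝒮 h𝒮 hSig).star.Sig w = M.Sig w := by
  ext t
  constructor
  · rintro ⟨s, hs, rfl⟩
    exact hs
  · exact fun ht => ⟨⟨t, hSig w ht⟩, ht, rfl⟩

theorem worldBisim_ofModel (w : M.W) : Model.WorldBisim M w (ofModel M hW 𝒮 h𝒮 hSig).star w := by
  refine Model.WorldBisim.of_relation (N := (ofModel M hW 𝒮 h𝒮 hSig).star) (Z := @Eq M.W) ?_ ?_ rfl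
  · rintro v _ rfl p
    rfl
  · rintro v _ rfl
    exact (egliMilner_eq.2 (Sig_star_ofModel v).symm).mono fun _ _ => egliMilner_eq.2

theorem isFinite_ofModel [Finite M.W] : (ofModel M hW 𝒮 h𝒮 hSig).IsFinite :=
  ⟨inferInstanceAs (Finite M.W), inferInstanceAs (Finite 𝒮)⟩

theorem locallyFull_ofModel (h : ∀ w, ∀ t ⊆ M.sigma w, t ∈ 𝒮) :
    (ofModel M hW 𝒮 h𝒮 hSig).LocallyFull := by
  intro w t ht
  refine ⟨⟨t, h w t (ht.trans ?_)⟩, rfl⟩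
  rintro v ⟨s, hs, hv⟩
  exact ⟨s.1, hs, hv⟩

end ofModel

theorem exists_isFinite_and_locallyFull : ∃ M : RelModel.{u, v} I, M.IsFinite ∧ M.LocallyFull := by
  let K : Model.{u, v} I :=
    { W := PUnit
      Sig := fun _ => Set.univ
      sig_nonempty := fun _ => Set.univ_nonempty
      sig_down := fun _ _ _ _ _ => trivial
      V := fun _ => ∅ }
  have : Finite K.W := inferInstanceAs (Finite PUnit)
  exact ⟨ofModel K ⟨PUnit.unit⟩ Set.univ isLowerSet_univ fun _ => subset_rfl, isFinite_ofModel,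
    locallyFull_ofModel fun _ _ _ => trivial⟩

theorem exists_ext_eq_of_subset (M : RelModel.{u, v} I) {s : M.S} {t : Set M.W}
    (h : t ⊆ M.ext s) : ∃ s', M.ext s' = t := M.local_powerset s t h

theorem ext_injective (M : RelModel.{u, v} I) : Function.Injective M.ext :=
  M.extensionality

/-- The restriction of the atoms to those in `J`: all other atoms become false. -/
def restrict (M : RelModel.{u, v} I) (J : Set I) : RelModel.{u, v} I :=
  { M with P := fun p w => p ∈ J ∧ M.P p w }

theorem contains_restrict {C : ModelClass} {M : RelModel.{u, v} I} (h : C.Contains M)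
    (J : Set I) : C.Contains (M.restrict J) :=
  h.of_imp id id

end RelModel

namespace FO

/-- The atoms occurring in a formula. -/
def atoms : {m n : ℕ} → FO I m n → Set I
  | _, _, .pred i _ => {i}
  | _, _, .imp φ ψ => φ.atoms ∪ ψ.atoms
  | _, _, .allW φ => φ.atoms
  | _, _, .allS φ => φ.atoms
  | _, _, _ => ∅

/-- The quantifier rank of a formula. -/
def rank : {m n : ℕ} → FO I m n → ℕ
  | _, _, .imp φ ψ => max φ.rank ψ.rank
  | _, _, .allW φ => φ.rank + 1
  | _, _, .allS φ => φ.rank + 1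
  | _, _, _ => 0

theorem finite_atoms {m n : ℕ} (φ : FO I m n) : φ.atoms.Finite := by
  induction φ with
  | pred i _ => exact Set.finite_singleton i
  | imp φ ψ hφ hψ => exact hφ.union hψ
  | allW _ hφ => exact hφ
  | allS _ hφ => exact hφ
  | _ => exact Set.finite_empty

theorem sat_restrict {M : RelModel.{u, v} I} {J : Set I} {m n : ℕ} {φ : FO I m n}
    (hφ : φ.atoms ⊆ J) (a : Fin m → M.W) (b : Fin n → M.S) :
    φ.Sat (M.restrict J) a b ↔ φ.Sat M a b := by
  induction φ with
  | pred i x => exact and_iff_right (hφ rfl)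
  | imp φ ψ ihφ ihψ =>
    exact imp_congr (ihφ (Set.subset_union_left.trans hφ) a b)
      (ihψ (Set.subset_union_right.trans hφ) a b)
  | allW φ ih => exact forall_congr' fun w => ih hφ (Fin.snoc a w) b
  | allS φ ih => exact forall_congr' fun s => ih hφ a (Fin.snoc b s)
  | _ => exact Iff.rfl

end FO

/-! ### The Ehrenfeucht–Fraïssé game -/

/-- The pairs of worlds in `Z` and the pairs of states in `Y` form a partial isomorphism. -/
structure IsPartialIso (M N : RelModel.{u, v} I) (Z : Set (M.W × N.W)) (Y : Set (M.S × N.S)) :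
    Prop where
  pred : ∀ z ∈ Z, ∀ i, M.P i z.1 ↔ N.P i z.2
  relE : ∀ z ∈ Z, ∀ y ∈ Y, M.E z.1 y.1 ↔ N.E z.2 y.2
  relEps : ∀ z ∈ Z, ∀ y ∈ Y, M.eps z.1 y.1 ↔ N.eps z.2 y.2
  eqW : ∀ z ∈ Z, ∀ z' ∈ Z, z.1 = z'.1 ↔ z.2 = z'.2
  eqS : ∀ y ∈ Y, ∀ y' ∈ Y, y.1 = y'.1 ↔ y.2 = y'.2

theorem IsPartialIso.mono {M N : RelModel.{u, v} I} {Z Z' : Set (M.W × N.W)}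
    {Y Y' : Set (M.S × N.S)} (h : IsPartialIso M N Z Y) (hZ : Z' ⊆ Z) (hY : Y' ⊆ Y) :
    IsPartialIso M N Z' Y' where
  pred z hz := h.pred z (hZ hz)
  relE z hz y hy := h.relE z (hZ hz) y (hY hy)
  relEps z hz y hy := h.relEps z (hZ hz) y (hY hy)
  eqW z hz z' hz' := h.eqW z (hZ hz) z' (hZ hz')
  eqS y hy y' hy' := h.eqS y (hY hy) y' (hY hy')

/-- Duplicator wins the two-sorted Ehrenfeucht–Fraïssé game with the given number of rounds from
the position in which the pairs of worlds in `Z` and the pairs of states in `Y` are pebbled. -/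
def DuplicatorWins (M N : RelModel.{u, v} I) :
    ℕ → Set (M.W × N.W) → Set (M.S × N.S) → Prop
  | 0, Z, Y => IsPartialIso M N Z Y
  | r + 1, Z, Y => IsPartialIso M N Z Y ∧
    Relator.BiTotal (fun w w' => DuplicatorWins M N r (insert (w, w') Z) Y) ∧
    Relator.BiTotal (fun s s' => DuplicatorWins M N r Z (insert (s, s') Y))

theorem snoc_mem_insert {α β : Type*} {m : ℕ} {Z : Set (α × β)} {a : Fin m → α} {a' : Fin m → β}
    (h : ∀ x, (a x, a' x) ∈ Z) (w : α) (w' : β) (x : Fin (m + 1)) :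
    ((Fin.snoc a w : Fin (m + 1) → α) x, (Fin.snoc a' w' : Fin (m + 1) → β) x) ∈
      insert (w, w') Z := by
  cases x using Fin.lastCases with
  | last => simp only [Fin.snoc_last, Set.mem_insert]
  | cast x => simpa only [Fin.snoc_castSucc] using Set.mem_insert_of_mem _ (h x)

namespace DuplicatorWins

variable {M N : RelModel.{u, v} I} {r : ℕ} {Z : Set (M.W × N.W)} {Y : Set (M.S × N.S)}

theorem isPartialIso (h : DuplicatorWins M N r Z Y) : IsPartialIso M N Z Y := by
  cases r with
  | zero => exact h
  | succ r => exact h.1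

theorem sat_iff {m n : ℕ} {φ : FO I m n} (h : DuplicatorWins M N r Z Y) (hφ : φ.rank ≤ r)
    {a : Fin m → M.W} {a' : Fin m → N.W} (ha : ∀ x, (a x, a' x) ∈ Z)
    {b : Fin n → M.S} {b' : Fin n → N.S} (hb : ∀ y, (b y, b' y) ∈ Y) :
    φ.Sat M a b ↔ φ.Sat N a' b' := by
  induction φ generalizing r Z Y with
  | pred i x => exact h.isPartialIso.pred _ (ha x) i
  | relE x y => exact h.isPartialIso.relE _ (ha x) _ (hb y)
  | relEps x y => exact h.isPartialIso.relEps _ (ha x) _ (hb y)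
  | eqW x y => exact h.isPartialIso.eqW _ (ha x) _ (ha y)
  | eqS x y => exact h.isPartialIso.eqS _ (hb x) _ (hb y)
  | falsum => exact Iff.rfl
  | imp φ ψ ihφ ihψ =>
    obtain ⟨hφ, hψ⟩ := max_le_iff.1 hφ
    exact imp_congr (ihφ h hφ ha hb) (ihψ h hψ ha hb)
  | allW φ ih =>
    obtain ⟨r, rfl⟩ := Nat.exists_eq_add_of_le' (Nat.le_of_add_left_le hφ)
    refine Relator.BiTotal.rel_forall h.2.1 fun w w' hw => ?_
    exact ih hw (Nat.le_of_succ_le_succ hφ) (snoc_mem_insert ha w w') hb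
  | allS φ ih =>
    obtain ⟨r, rfl⟩ := Nat.exists_eq_add_of_le' (Nat.le_of_add_left_le hφ)
    refine Relator.BiTotal.rel_forall h.2.2 fun s s' hs => ?_
    exact ih hs (Nat.le_of_succ_le_succ hφ) ha (snoc_mem_insert hb s s')

end DuplicatorWins

/-! ### Layered models -/

/-- The indices of the copies in a layered model. The flag tells whether the last layer of the
copy loops (`true`) or is truncated (`false`); for each flag there are `N + 1` copies. -/
abbrev Copy (N : ℕ) : Type := Fin (N + 1) × Bool

theorem exists_fresh_copy {N : ℕ} (l : List (Copy N)) (hl : l.length ≤ N) (flag : Bool) :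
    ∃ c ∉ l, c.2 = flag := by
  have hcard : l.toFinset.card < (Finset.univ ×ˢ {flag} : Finset (Copy N)).card := by
    have := l.toFinset_card_le
    simp only [Finset.card_product, Finset.card_univ, Fintype.card_fin, Finset.card_singleton]
    omega
  obtain ⟨c, hc, hcl⟩ := Finset.exists_mem_notMem_of_card_lt_card hcard
  exact ⟨c, fun h => hcl (List.mem_toFinset.2 h),
    Finset.mem_singleton.1 (Finset.mem_product.1 hc).2⟩

/-- The layer following `i`; the last layer is followed by itself. -/
def nextLayer {n : ℕ} (i : Fin (n + 1)) : Fin (n + 1) := ⟨min (i + 1) n, by omega⟩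

/-- The set `t` placed in layer `i` of the copy `c`. -/
def cell {N n : ℕ} {X : Type u} (c : Copy N) (i : Fin (n + 1)) (t : Set X) :
    Set (Copy N × Fin (n + 1) × X) := (fun x => (c, i, x)) '' t

section cell

variable {N n : ℕ} {X : Type u} {c c' : Copy N} {i i' : Fin (n + 1)} {t t' : Set X}

theorem mk_mem_cell {x : X} : (c, i, x) ∈ cell c' i' t ↔ c = c' ∧ i = i' ∧ x ∈ t := by
  constructor
  · rintro ⟨x, hx, ⟨⟩⟩
    exact ⟨rfl, rfl, hx⟩
  · rintro ⟨rfl, rfl, hx⟩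
    exact Set.mem_image_of_mem _ hx

theorem cell_empty : cell c i (∅ : Set X) = ∅ := Set.image_empty _

theorem cell_injective : Function.Injective (cell c i : Set X → _) :=
  (Prod.mk_right_injective c |>.comp (Prod.mk_right_injective i)).image_injective

theorem exists_cell_eq_of_subset {r : Set (Copy N × Fin (n + 1) × X)} (h : r ⊆ cell c i t) :
    ∃ t' ⊆ t, cell c i t' = r := Set.subset_image_iff.1 h

theorem cell_eq_cell_iff :
    cell c i t = cell c' i' t' ↔ (t = ∅ ∧ t' = ∅) ∨ (c = c' ∧ i = i' ∧ t = t') := by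
  constructor
  · intro h
    rcases t.eq_empty_or_nonempty with rfl | ⟨x, hx⟩
    · exact Or.inl ⟨rfl, Set.image_eq_empty.1 (h.symm.trans cell_empty)⟩
    · obtain ⟨rfl, rfl, -⟩ := mk_mem_cell.1 (h.subset (Set.mem_image_of_mem _ hx))
      exact Or.inr ⟨rfl, rfl, cell_injective h⟩
  · rintro (⟨rfl, rfl⟩ | ⟨rfl, rfl, rfl⟩)
    · rw [cell_empty, cell_empty]
    · rfl

end cell

/-- The disjoint union of looping and truncated copies of `M`, each unravelled into the layers
`0, …, n`: the inquisitive state of a world lives in the next layer of its copy, but it is trivial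
in the last layer of a truncated copy. -/
def Model.layered (M : Model.{u, v} I) (N n : ℕ) : Model.{u, v} I where
  W := Copy N × Fin (n + 1) × M.W
  Sig x := cell x.1 (nextLayer x.2.1) ''
    {t ∈ M.Sig x.2.2 | t.Nonempty → (x.2.1 : ℕ) < n ∨ x.1.2 = true}
  sig_nonempty x :=
    Set.Nonempty.image _ ⟨∅, M.empty_mem_Sig x.2.2, fun h => h.ne_empty.elim rfl⟩
  sig_down x := by
    rintro _ t ⟨t₀, ⟨ht₀, h⟩, rfl⟩ ht
    obtain ⟨t', ht', rfl⟩ := exists_cell_eq_of_subset ht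
    exact ⟨t', ⟨M.sig_down _ _ _ ht₀ ht', fun hne => h (hne.mono ht')⟩, rfl⟩
  V p := {x | x.2.2 ∈ M.V p}

namespace RelModel

/-- The relational counterpart of `Model.layered`. -/
def layered (M : RelModel.{u, v} I) (N n : ℕ) : RelModel.{u, v} I :=
  ofModel (M.star.layered N n) ⟨((0, true), 0, M.nonempty_W.some)⟩
    {t | ∃ c i s, t = cell c i (M.ext s)}
    (by
      rintro _ t ht ⟨c, i, s, rfl⟩
      obtain ⟨t', ht', rfl⟩ := exists_cell_eq_of_subset ht
      obtain ⟨s', rfl⟩ := M.exists_ext_eq_of_subset ht'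
      exact ⟨c, i, s', rfl⟩)
    (by
      rintro x _ ⟨_, ⟨⟨s, -, rfl⟩, -⟩, rfl⟩
      exact ⟨_, _, s, rfl⟩)

theorem contains_layered {C : ModelClass} {M : RelModel.{u, v} I} (h : C.Contains M)
    (N n : ℕ) : C.Contains (M.layered N n) := by
  refine h.of_imp (fun hfin => ?_) fun hfull => locallyFull_ofModel fun x t ht => ?_
  · have : Finite M.W := hfin.1
    have : Finite (M.star.layered N n).W := inferInstanceAs (Finite (Copy N × Fin (n + 1) × M.W))
    exact isFinite_ofModel
  · have hsigma : (M.star.layered N n).sigma x ⊆ cell x.1 (nextLayer x.2.1) (M.R x.2.2) := by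
      rintro _ ⟨_, ⟨_, ⟨⟨s, hs, rfl⟩, -⟩, rfl⟩, v, hv, rfl⟩
      exact Set.mem_image_of_mem _ ⟨s, hs, hv⟩
    obtain ⟨t', ht', rfl⟩ := exists_cell_eq_of_subset (ht.trans hsigma)
    obtain ⟨s, rfl⟩ := hfull x.2.2 t' ht'
    exact ⟨_, _, s, rfl⟩

section layered

variable {M : RelModel.{u, v} I} {N n : ℕ}

/-- The world `w` in layer `i` of the copy `c`. -/
def layeredWorld (M : RelModel.{u, v} I) {N n : ℕ} (c : Copy N) (i : Fin (n + 1)) (w : M.W) :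
    (M.layered N n).W := (c, i, w)

/-- The state `s` in layer `i` of the copy `c`. -/
def layeredState (M : RelModel.{u, v} I) {N n : ℕ} (c : Copy N) (i : Fin (n + 1)) (s : M.S) :
    (M.layered N n).S := ⟨cell c i (M.ext s), c, i, s, rfl⟩

theorem exists_layeredState_eq (s : (M.layered N n).S) :
    ∃ c i s₀, M.layeredState c i s₀ = s := by
  obtain ⟨_, c, i, s₀, rfl⟩ := s
  exact ⟨c, i, s₀, rfl⟩

variable {c c' : Copy N} {i i' : Fin (n + 1)} {w w' : M.W} {s s' : M.S}

theorem layeredWorld_eq_iff :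
    M.layeredWorld c i w = M.layeredWorld c' i' w' ↔ c = c' ∧ i = i' ∧ w = w' :=
  Prod.mk_inj.trans (and_congr_right fun _ => Prod.mk_inj)

theorem layeredState_eq_iff : M.layeredState c i s = M.layeredState c' i' s' ↔
    (M.ext s = ∅ ∧ M.ext s' = ∅) ∨ (c = c' ∧ i = i' ∧ s = s') := by
  rw [← M.ext_injective.eq_iff (a := s)]
  exact Subtype.ext_iff.trans cell_eq_cell_iff

theorem layered_eps_iff :
    (M.layered N n).eps (M.layeredWorld c i w) (M.layeredState c' i' s) ↔
      c = c' ∧ i = i' ∧ M.eps w s := mk_mem_cell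

theorem layered_E_iff : (M.layered N n).E (M.layeredWorld c i w) (M.layeredState c' i' s) ↔
    M.ext s = ∅ ∨ (c = c' ∧ nextLayer i = i' ∧ ((i : ℕ) < n ∨ c.2 = true) ∧ M.E w s) := by
  constructor
  · rintro ⟨_, ⟨⟨s₀, hs₀, rfl⟩, h⟩, heq⟩
    rcases cell_eq_cell_iff.1 heq with ⟨-, hs⟩ | ⟨rfl, rfl, hs⟩
    · exact Or.inl hs
    · obtain rfl := M.ext_injective hs
      exact (M.ext s₀).eq_empty_or_nonempty.imp_right fun hne => ⟨rfl, rfl, h hne, hs₀⟩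
  · rintro (hs | ⟨rfl, rfl, h, hE⟩)
    · refine ⟨∅, ⟨M.star.empty_mem_Sig w, fun h => h.ne_empty.elim rfl⟩, ?_⟩
      exact cell_eq_cell_iff.2 (Or.inl ⟨rfl, hs⟩)
    · exact ⟨M.ext s, ⟨⟨s, hE, rfl⟩, fun _ => h⟩, rfl⟩

end layered

end RelModel

/-! ### The game on layered models -/

/-- A pair of pebbles in two layered models: they lie in the same layer of the copies `left` and
`right`. Their positions inside that layer agree and are not recorded. -/
structure PebblePair (N n : ℕ) where
  left : Copy N
  right : Copy N
  layer : Fin (n + 1)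

/-- The layers of the two pairs of pebbles are at distance at most `d`. -/
def PebblePair.Near {N n : ℕ} (d : ℕ) (p q : PebblePair N n) : Prop :=
  (p.layer : ℕ) ≤ q.layer + d ∧ (q.layer : ℕ) ≤ p.layer + d

theorem PebblePair.Near.trans {N n d : ℕ} {p q r : PebblePair N n} (hpq : p.Near d q)
    (hqr : q.Near d r) : p.Near (2 * d) r := by
  obtain ⟨h₁, h₂⟩ := hpq
  obtain ⟨h₃, h₄⟩ := hqr
  exact ⟨by omega, by omega⟩

section pairs

variable {M : RelModel.{u, v} I} {N n : ℕ} {L : List (PebblePair N n)}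

/-- The pairs of worlds marked by the pebbles in `L`. -/
def worldPairs (M : RelModel.{u, v} I) (L : List (PebblePair N n)) :
    Set ((M.layered N n).W × (M.layered N n).W) :=
  {z | ∃ p ∈ L, ∃ w, (M.layeredWorld p.left p.layer w, M.layeredWorld p.right p.layer w) = z}

/-- The pairs of states marked by the pebbles in `L`. -/
def statePairs (M : RelModel.{u, v} I) (L : List (PebblePair N n)) :
    Set ((M.layered N n).S × (M.layered N n).S) :=
  {y | ∃ p ∈ L, ∃ s, (M.layeredState p.left p.layer s, M.layeredState p.right p.layer s) = y}

theorem worldPairs_subset_cons {p : PebblePair N n} : worldPairs M L ⊆ worldPairs M (p :: L) :=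
  fun _ ⟨q, hq, h⟩ => ⟨q, List.mem_cons_of_mem p hq, h⟩

theorem statePairs_subset_cons {p : PebblePair N n} : statePairs M L ⊆ statePairs M (p :: L) :=
  fun _ ⟨q, hq, h⟩ => ⟨q, List.mem_cons_of_mem p hq, h⟩

end pairs

/-- The invariant of Duplicator's strategy: both sides agree on which of the pebbles at distance
at most `d` lie in the same copy, and on the flags of the copies of those pebbles which are at
distance at most `d` from the last layer. -/
structure Matched {N n : ℕ} (d : ℕ) (L : List (PebblePair N n)) : Prop where
  eq_iff : ∀ p ∈ L, ∀ q ∈ L, p.Near d q → (p.left = q.left ↔ p.right = q.right)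
  flag : ∀ p ∈ L, n ≤ p.layer + d → p.left.2 = p.right.2

namespace Matched

variable {M : RelModel.{u, v} I} {N n d : ℕ} {L : List (PebblePair N n)}

theorem mono {d' : ℕ} (h : Matched d L) (hd : d' ≤ d) : Matched d' L where
  eq_iff p hp q hq hpq :=
    h.eq_iff p hp q hq ⟨hpq.1.trans (by omega), hpq.2.trans (by omega)⟩
  flag p hp hn := h.flag p hp (hn.trans (by omega))

theorem cons (h : Matched d L) {q : PebblePair N n}
    (heq : ∀ p ∈ L, q.Near d p → (q.left = p.left ↔ q.right = p.right))
    (hflag : n ≤ q.layer + d → q.left.2 = q.right.2) : Matched d (q :: L) where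
  eq_iff := by
    simp only [List.forall_mem_cons]
    refine ⟨⟨fun _ => trivial, heq⟩, fun p hp => ⟨fun hpq => ?_, h.eq_iff p hp⟩⟩
    rw [eq_comm, heq p hp hpq.symm, eq_comm]
  flag := List.forall_mem_cons.2 ⟨hflag, h.flag⟩

theorem swap (h : Matched d L) :
    Matched d (L.map fun p => (⟨p.right, p.left, p.layer⟩ : PebblePair N n)) where
  eq_iff := by
    simp only [List.forall_mem_map]
    exact fun p hp q hq hpq => (h.eq_iff p hp q hq hpq).symm
  flag := by
    simp only [List.forall_mem_map]
    exact fun p hp hn => (h.flag p hp hn).symm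

theorem exists_cons_right (h : Matched (2 * d) L) (hL : L.length ≤ N) (c : Copy N)
    (i : Fin (n + 1)) : ∃ c', Matched d (⟨c, c', i⟩ :: L) := by
  have hd : Matched d L := h.mono (by omega)
  by_cases hc : ∃ p ∈ L, p.left = c ∧ p.Near d ⟨c, c, i⟩
  · obtain ⟨p, hp, rfl, hpi⟩ := hc
    refine ⟨p.right, hd.cons (fun q hq hiq => h.eq_iff p hp q hq (hpi.trans hiq)) fun hn => ?_⟩
    refine h.flag p hp (hn.trans ?_)
    rw [two_mul, ← add_assoc]
    exact Nat.add_le_add_right hpi.2 d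
  · obtain ⟨c', hc', hflag⟩ := exists_fresh_copy (L.map PebblePair.right)
      (L.length_map _ |>.trans_le hL) c.2
    refine ⟨c', hd.cons (fun q hq hiq => iff_of_false ?_ ?_) fun _ => hflag.symm⟩
    · exact fun hcq => hc ⟨q, hq, hcq.symm, hiq.symm⟩
    · exact fun hcq => hc' (List.mem_map.2 ⟨q, hq, hcq.symm⟩)

theorem exists_cons_left (h : Matched (2 * d) L) (hL : L.length ≤ N) (c' : Copy N)
    (i : Fin (n + 1)) : ∃ c, Matched d (⟨c, c', i⟩ :: L) := by
  obtain ⟨c, hc⟩ := h.swap.exists_cons_right ((L.length_map _).trans_le hL) c' i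
  refine ⟨c, ?_⟩
  simpa only [List.map_cons, List.map_map, Function.comp_def, List.map_id'] using hc.swap

theorem left_eq_iff_of_layer_eq (h : Matched d L) {p q : PebblePair N n} (hp : p ∈ L)
    (hq : q ∈ L) (hpq : p.layer = q.layer) : p.left = q.left ↔ p.right = q.right :=
  h.eq_iff p hp q hq ⟨by rw [hpq]; omega, by rw [hpq]; omega⟩

theorem left_eq_iff_of_nextLayer_eq (h : Matched 1 L) {p q : PebblePair N n} (hp : p ∈ L)
    (hq : q ∈ L) (hpq : nextLayer p.layer = q.layer) : p.left = q.left ↔ p.right = q.right := by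
  have hval : min ((p.layer : ℕ) + 1) n = q.layer := congrArg Fin.val hpq
  exact h.eq_iff p hp q hq ⟨by omega, by omega⟩

theorem isPartialIso (h : Matched 1 L) : IsPartialIso (M.layered N n) (M.layered N n)
    (worldPairs M L) (statePairs M L) where
  pred := by
    rintro _ ⟨p, -, w, rfl⟩ i
    rfl
  relE := by
    rintro _ ⟨p, hp, w, rfl⟩ _ ⟨q, hq, s, rfl⟩
    simp only [RelModel.layered_E_iff]
    refine or_congr_right ?_
    rw [and_congr_left_iff.2 fun hE => h.left_eq_iff_of_nextLayer_eq hp hq hE.1]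
    refine and_congr_right fun _ => and_congr_right fun _ => and_congr_left fun _ => ?_
    refine or_congr_right' fun hn => ?_
    rw [h.flag p hp (by omega)]
  relEps := by
    rintro _ ⟨p, hp, w, rfl⟩ _ ⟨q, hq, s, rfl⟩
    simp only [RelModel.layered_eps_iff]
    exact and_congr_left fun he => h.left_eq_iff_of_layer_eq hp hq he.1
  eqW := by
    rintro _ ⟨p, hp, w, rfl⟩ _ ⟨q, hq, w', rfl⟩
    simp only [RelModel.layeredWorld_eq_iff]
    exact and_congr_left fun he => h.left_eq_iff_of_layer_eq hp hq he.1
  eqS := by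
    rintro _ ⟨p, hp, s, rfl⟩ _ ⟨q, hq, s', rfl⟩
    simp only [RelModel.layeredState_eq_iff]
    exact or_congr_right (and_congr_left fun he => h.left_eq_iff_of_layer_eq hp hq he.1)

theorem insert_subset_worldPairs_cons {Z} (hZ : Z ⊆ worldPairs M L) (p : PebblePair N n)
    (w : M.W) :
    insert (M.layeredWorld p.left p.layer w, M.layeredWorld p.right p.layer w) Z ⊆
      worldPairs M (p :: L) :=
  Set.insert_subset ⟨p, List.mem_cons_self, w, rfl⟩ (hZ.trans worldPairs_subset_cons)

theorem insert_subset_statePairs_cons {Y} (hY : Y ⊆ statePairs M L) (p : PebblePair N n)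
    (s : M.S) :
    insert (M.layeredState p.left p.layer s, M.layeredState p.right p.layer s) Y ⊆
      statePairs M (p :: L) :=
  Set.insert_subset ⟨p, List.mem_cons_self, s, rfl⟩ (hY.trans statePairs_subset_cons)

/-- The radius of the invariant halves with every round, and `1` suffices at the end. -/
theorem duplicatorWins {r : ℕ} (h : Matched (2 ^ r) L) (hN : L.length + r ≤ N + 1)
    {Z Y} (hZ : Z ⊆ worldPairs M L) (hY : Y ⊆ statePairs M L) :
    DuplicatorWins (M.layered N n) (M.layered N n) r Z Y := by
  induction r generalizing L Z Y with
  | zero => exact h.isPartialIso.mono hZ hY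
  | succ r ih =>
    have hiso := (h.mono Nat.one_le_two_pow).isPartialIso.mono hZ hY
    rw [pow_succ'] at h
    have hlen : L.length ≤ N := by omega
    have hcons {c c' : Copy N} {i} (hm : Matched (2 ^ r) (⟨c, c', i⟩ :: L)) {Z' Y'}
        (hZ' : Z' ⊆ worldPairs M (⟨c, c', i⟩ :: L)) (hY' : Y' ⊆ statePairs M (⟨c, c', i⟩ :: L)) :
        DuplicatorWins (M.layered N n) (M.layered N n) r Z' Y' :=
      ih hm (by rw [List.length_cons]; omega) hZ' hY'
    refine ⟨hiso, ⟨?_, ?_⟩, ?_, ?_⟩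
    · rintro ⟨c, i, w⟩
      obtain ⟨c', hm⟩ := h.exists_cons_right hlen c i
      exact ⟨M.layeredWorld c' i w, hcons hm (insert_subset_worldPairs_cons hZ ⟨c, c', i⟩ w)
        (hY.trans statePairs_subset_cons)⟩
    · rintro ⟨c', i, w⟩
      obtain ⟨c, hm⟩ := h.exists_cons_left hlen c' i
      exact ⟨M.layeredWorld c i w, hcons hm (insert_subset_worldPairs_cons hZ ⟨c, c', i⟩ w)
        (hY.trans statePairs_subset_cons)⟩
    · intro s
      obtain ⟨c, i, s, rfl⟩ := RelModel.exists_layeredState_eq s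
      obtain ⟨c', hm⟩ := h.exists_cons_right hlen c i
      exact ⟨M.layeredState c' i s, hcons hm (hZ.trans worldPairs_subset_cons)
        (insert_subset_statePairs_cons hY ⟨c, c', i⟩ s)⟩
    · intro s'
      obtain ⟨c', i, s, rfl⟩ := RelModel.exists_layeredState_eq s'
      obtain ⟨c, hm⟩ := h.exists_cons_left hlen c' i
      exact ⟨M.layeredState c i s, hcons hm (hZ.trans worldPairs_subset_cons)
        (insert_subset_statePairs_cons hY ⟨c, c', i⟩ s)⟩

theorem singleton (c c' : Copy N) (hd : d < n) : Matched d [(⟨c, c', 0⟩ : PebblePair N n)] where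
  eq_iff := by simp only [List.forall_mem_singleton, implies_true]
  flag := by
    simp only [List.forall_mem_singleton, Fin.val_zero, zero_add]
    exact fun h => absurd h hd.not_ge

end Matched

theorem FO.sat_layeredWorld_iff (M : RelModel.{u, v} I) {φ : FO I 1 0} {N n : ℕ}
    (hN : φ.rank ≤ N) (hn : 2 ^ φ.rank < n) (c c' : Copy N) (w : M.W) :
    φ.Sat (M.layered N n) ![M.layeredWorld c 0 w] ![] ↔
      φ.Sat (M.layered N n) ![M.layeredWorld c' 0 w] ![] := by
  have hwins := (Matched.singleton c c' hn).duplicatorWins (M := M)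
    (by rw [List.length_singleton]; omega) subset_rfl (Set.empty_subset _)
  exact hwins.sat_iff le_rfl (Fin.forall_fin_one.2 ⟨_, List.mem_singleton_self _, w, rfl⟩)
    fun y => y.elim0

theorem FO.sat_layeredState_iff (M : RelModel.{u, v} I) {φ : FO I 0 1} {N n : ℕ}
    (hN : φ.rank ≤ N) (hn : 2 ^ φ.rank < n) (c c' : Copy N) (s : M.S) :
    φ.Sat (M.layered N n) ![] ![M.layeredState c 0 s] ↔
      φ.Sat (M.layered N n) ![] ![M.layeredState c' 0 s] := by
  have hwins := (Matched.singleton c c' hn).duplicatorWins (M := M)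
    (by rw [List.length_singleton]; omega) (Set.empty_subset _) subset_rfl
  exact hwins.sat_iff le_rfl (fun x => x.elim0)
    (Fin.forall_fin_one.2 ⟨_, List.mem_singleton_self _, s, rfl⟩)

/-! ### Bisimulations of layered models -/

namespace Model

variable {M M' : Model.{u, v} I} {J : Set I} {N n : ℕ}

theorem Sig_layered_of_lt_or_looping {c : Copy N} {i : Fin (n + 1)} (h : (i : ℕ) < n ∨ c.2 = true)
    (w : M.W) : (M.layered N n).Sig (c, i, w) = cell c (nextLayer i) '' M.Sig w :=
  congrArg (cell c (nextLayer i) '' ·) (Set.sep_eq_self_iff_mem_true.2 fun _ _ _ => h)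

theorem Sig_layered_of_last {c : Copy N} {i : Fin (n + 1)} (h : ¬((i : ℕ) < n ∨ c.2 = true))
    (w : M.W) : (M.layered N n).Sig (c, i, w) = {∅} := by
  have hsep : {t ∈ M.Sig w | t.Nonempty → (i : ℕ) < n ∨ c.2 = true} = {∅} := by
    simp only [h, imp_false, Set.not_nonempty_iff_eq_empty]
    exact Set.eq_singleton_iff_unique_mem.2 ⟨⟨M.empty_mem_Sig w, rfl⟩, fun _ ht => ht.2⟩
  exact (congrArg (cell c (nextLayer i) '' ·) hsep).trans
    (Set.image_singleton.trans (congrArg _ cell_empty))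

theorem worldBisim_layered_of_looping (M : Model.{u, v} I) {c : Copy N} (hc : c.2 = true)
    (i : Fin (n + 1)) (w : M.W) : WorldBisim M w (M.layered N n) (c, i, w) := by
  refine WorldBisim.of_relation (N := M.layered N n) (Z := fun w x => x.1.2 = true ∧ w = x.2.2)
    ?_ ?_ ⟨hc, rfl⟩
  · rintro _ ⟨c, i, w⟩ ⟨-, rfl⟩ p
    rfl
  · rintro w ⟨c, i, _⟩ ⟨hc, rfl⟩
    rw [Sig_layered_of_lt_or_looping (Or.inr hc)]
    refine egliMilner_image_right.2 ((egliMilner_eq.2 rfl).mono ?_)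
    rintro s _ rfl
    exact egliMilner_image_right.2 ((egliMilner_eq.2 rfl).mono fun _ _ h => ⟨hc, h⟩)

/-- In a truncated copy only `n - i` steps of the bisimulation game can start in layer `i`. -/
theorem worldBisim_layered_of_truncated {c : Copy N} (hc : c.2 = false) {i : Fin (n + 1)}
    {w : M.W} {w' : M'.W} (h : M.bisimType J (n - i) w = M'.bisimType J (n - i) w') :
    WorldBisim ((M.restrict J).layered N n) (c, i, w) ((M'.restrict J).layered N n) (c, i, w') := by
  refine WorldBisim.of_relation (M := (M.restrict J).layered N n)
    (N := (M'.restrict J).layered N n)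
    (Z := fun x x' => ∃ i : Fin (n + 1), ∃ w w', x = (c, i, w) ∧ x' = (c, i, w') ∧
      M.bisimType J (n - i) w = M'.bisimType J (n - i) w') ?_ ?_ ⟨i, w, w', rfl, rfl, h⟩
  · rintro _ _ ⟨i, w, w', rfl, rfl, h⟩ p
    exact and_congr_right fun hp => Set.ext_iff.1 (atomsAt_eq_of_bisimType_eq h) ⟨p, hp⟩
  · rintro _ _ ⟨i, w, w', rfl, rfl, h⟩
    by_cases hi : (i : ℕ) < n
    · have hsub : n - (i : ℕ) = n - (nextLayer i : ℕ) + 1 := by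
        simp only [nextLayer]
        omega
      rw [hsub] at h
      rw [Sig_layered_of_lt_or_looping (Or.inl hi), Sig_layered_of_lt_or_looping (Or.inl hi)]
      refine egliMilner_image_image.2 ((egliMilner_Sig_of_bisimType_succ_eq h).mono ?_)
      refine fun t t' ht => egliMilner_image_image.2 (ht.mono fun v v' hv => ?_)
      exact ⟨nextLayer i, v, v', rfl, rfl, hv⟩
    · have hlast : ¬((i : ℕ) < n ∨ c.2 = true) := by simp only [hi, hc]; decide
      rw [Sig_layered_of_last hlast, Sig_layered_of_last hlast]
      exact egliMilner_singleton.2 ⟨fun _ h => h.elim, fun _ h => h.elim⟩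

end Model

namespace RelModel

variable {M M' : RelModel.{u, v} I} {J : Set I} {N n : ℕ} {c : Copy N}

theorem worldBisim_star_layered (M : RelModel.{u, v} I) (c : Copy N) (i : Fin (n + 1)) (w : M.W) :
    Model.WorldBisim (M.star.layered N n) (c, i, w) (M.layered N n).star (M.layeredWorld c i w) :=
  worldBisim_ofModel _

theorem worldBisim_layeredWorld_of_looping (hc : c.2 = true) (i : Fin (n + 1)) (w : M.W) :
    Model.WorldBisim M.star w (M.layered N n).star (M.layeredWorld c i w) :=
  (M.star.worldBisim_layered_of_looping hc i w).trans (M.worldBisim_star_layered c i w)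

theorem stateBisim_layeredState_of_looping (hc : c.2 = true) (i : Fin (n + 1)) (s : M.S) :
    Model.StateBisim M.star (M.ext s) (M.layered N n).star
      ((M.layered N n).ext (M.layeredState c i s)) := by
  refine egliMilner_image_right.2 ((egliMilner_eq.2 rfl).mono ?_)
  rintro w _ rfl
  exact worldBisim_layeredWorld_of_looping hc i w

theorem worldBisim_layeredWorld_of_truncated (hc : c.2 = false) {w : M.W} {w' : M'.W}
    (h : M.star.bisimType J n w = M'.star.bisimType J n w') :
    Model.WorldBisim ((M.restrict J).layered N n).star ((M.restrict J).layeredWorld c 0 w)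
      ((M'.restrict J).layered N n).star ((M'.restrict J).layeredWorld c 0 w') :=
  ((M.restrict J).worldBisim_star_layered c 0 w).symm.trans
    ((Model.worldBisim_layered_of_truncated (i := 0) hc h).trans
      ((M'.restrict J).worldBisim_star_layered c 0 w'))

theorem stateBisim_layeredState_of_truncated (hc : c.2 = false) {s : M.S} {s' : M'.S}
    (h : M.star.bisimType J n '' M.ext s = M'.star.bisimType J n '' M'.ext s') :
    Model.StateBisim ((M.restrict J).layered N n).star
      (((M.restrict J).layered N n).ext ((M.restrict J).layeredState c 0 s))
      ((M'.restrict J).layered N n).star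
      (((M'.restrict J).layered N n).ext ((M'.restrict J).layeredState c 0 s')) :=
  egliMilner_image_image.2 ((egliMilner_image_image.1 (egliMilner_eq.2 h)).mono
    fun _ _ => worldBisim_layeredWorld_of_truncated hc)

end RelModel

/-! ### The characterisation -/

namespace WorldProperty

variable {C : ModelClass} {Q : WorldProperty.{u, v} I}

theorem FODefinable.exists_bisimType_invariant (hFO : Q.FODefinable C) (hB : Q.BisimInvariant C) :
    ∃ (J : Set I) (n : ℕ), J.Finite ∧ ∀ M N : RelModel.{u, v} I, C.Contains M → C.Contains N →
      ∀ (w : M.W) (w' : N.W), M.star.bisimType J n w = N.star.bisimType J n w' →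
        (Q M w ↔ Q N w') := by
  obtain ⟨φ, hφ⟩ := hFO
  let n := 2 ^ φ.rank + 1
  let T (M : RelModel.{u, v} I) := (M.restrict φ.atoms).layered φ.rank n
  have hT {M : RelModel.{u, v} I} (hM : C.Contains M) : C.Contains (T M) :=
    RelModel.contains_layered (RelModel.contains_restrict hM φ.atoms) φ.rank n
  let pt (M : RelModel.{u, v} I) (flag : Bool) (w : M.W) : (T M).W :=
    (M.restrict φ.atoms).layeredWorld (0, flag) 0 w
  have htruncated (M : RelModel.{u, v} I) (hM : C.Contains M) (w : M.W) :
      Q M w ↔ Q (T M) (pt M false w) := by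
    have hMr := RelModel.contains_restrict hM φ.atoms
    calc
      Q M w ↔ φ.Sat M ![w] ![] := hφ M hM w
      _ ↔ φ.Sat (M.restrict φ.atoms) ![w] ![] := (FO.sat_restrict subset_rfl ![w] ![]).symm
      _ ↔ Q (M.restrict φ.atoms) w := (hφ _ hMr w).symm
      _ ↔ Q (T M) (pt M true w) :=
        hB _ _ hMr (hT hM) w _
          (RelModel.worldBisim_layeredWorld_of_looping (M := M.restrict φ.atoms)
            (c := (0, true)) rfl 0 w)
      _ ↔ φ.Sat (T M) ![pt M true w] ![] := hφ _ (hT hM) _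
      _ ↔ φ.Sat (T M) ![pt M false w] ![] :=
        FO.sat_layeredWorld_iff (M.restrict φ.atoms) le_rfl (Nat.lt_succ_self _) _ _ w
      _ ↔ Q (T M) (pt M false w) := (hφ _ (hT hM) _).symm
  refine ⟨φ.atoms, n, φ.finite_atoms, fun M N hM hN w w' h => ?_⟩
  rw [htruncated M hM, htruncated N hN]
  exact hB _ _ (hT hM) (hT hN) _ _ (RelModel.worldBisim_layeredWorld_of_truncated rfl h)

theorem FODefinable.inqDefinable (hFO : Q.FODefinable C) (hB : Q.BisimInvariant C) :
    Q.InqDefinable C := by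
  obtain ⟨J, n, hJ, hinv⟩ := hFO.exists_bisimType_invariant hB
  obtain ⟨φ, hφ⟩ := TruthDefinable.bisimType_mem.{u} (n := n) hJ
    {τ | ∃ M : RelModel.{u, v} I, C.Contains M ∧ ∃ w : M.W, Q M w ∧ M.star.bisimType J n w = τ}
  refine ⟨φ, fun M hM w => Iff.trans ⟨fun hw => ⟨M, hM, w, hw, rfl⟩, ?_⟩ (hφ M.star w).symm⟩
  rintro ⟨N, hN, w', hw', h⟩
  exact (hinv N M hN hM w' w h).1 hw'

theorem InqDefinable.bisimInvariant (h : Q.InqDefinable C) : Q.BisimInvariant C := by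
  obtain ⟨φ, hφ⟩ := h
  intro M N hM hN w w' hw
  rw [hφ M hM, hφ N hN]
  exact hw.truth_iff φ

end WorldProperty

namespace StateProperty

variable {C : ModelClass} {Q : StateProperty.{u, v} I}

theorem FODefinable.exists_bisimType_invariant (hFO : Q.FODefinable C) (hB : Q.BisimInvariant C) :
    ∃ (J : Set I) (n : ℕ), J.Finite ∧ ∀ M N : RelModel.{u, v} I, C.Contains M → C.Contains N →
      ∀ (s : M.S) (s' : N.S),
        M.star.bisimType J n '' M.ext s = N.star.bisimType J n '' N.ext s' →
          (Q M s ↔ Q N s') := by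
  obtain ⟨φ, hφ⟩ := hFO
  let n := 2 ^ φ.rank + 1
  let T (M : RelModel.{u, v} I) := (M.restrict φ.atoms).layered φ.rank n
  have hT {M : RelModel.{u, v} I} (hM : C.Contains M) : C.Contains (T M) :=
    RelModel.contains_layered (RelModel.contains_restrict hM φ.atoms) φ.rank n
  let pt (M : RelModel.{u, v} I) (flag : Bool) (s : M.S) : (T M).S :=
    (M.restrict φ.atoms).layeredState (0, flag) 0 s
  have htruncated (M : RelModel.{u, v} I) (hM : C.Contains M) (s : M.S) :
      Q M s ↔ Q (T M) (pt M false s) := by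
    have hMr := RelModel.contains_restrict hM φ.atoms
    calc
      Q M s ↔ φ.Sat M ![] ![s] := hφ M hM s
      _ ↔ φ.Sat (M.restrict φ.atoms) ![] ![s] := (FO.sat_restrict subset_rfl ![] ![s]).symm
      _ ↔ Q (M.restrict φ.atoms) s := (hφ _ hMr s).symm
      _ ↔ Q (T M) (pt M true s) :=
        hB _ _ hMr (hT hM) s _
          (RelModel.stateBisim_layeredState_of_looping (M := M.restrict φ.atoms)
            (c := (0, true)) rfl 0 s)
      _ ↔ φ.Sat (T M) ![] ![pt M true s] := hφ _ (hT hM) _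
      _ ↔ φ.Sat (T M) ![] ![pt M false s] :=
        FO.sat_layeredState_iff (M.restrict φ.atoms) le_rfl (Nat.lt_succ_self _) _ _ s
      _ ↔ Q (T M) (pt M false s) := (hφ _ (hT hM) _).symm
  refine ⟨φ.atoms, n, φ.finite_atoms, fun M N hM hN s s' h => ?_⟩
  rw [htruncated M hM, htruncated N hN]
  exact hB _ _ (hT hM) (hT hN) _ _ (RelModel.stateBisim_layeredState_of_truncated rfl h)

theorem FODefinable.inqDefinable (hFO : Q.FODefinable C) (hne : Q.NonemptyOver C)
    (hdown : Q.DownwardClosed C) (hB : Q.BisimInvariant C) : Q.InqDefinable C := by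
  obtain ⟨J, n, hJ, hinv⟩ := hFO.exists_bisimType_invariant hB
  have hF : {X | ∃ M : RelModel.{u, v} I, C.Contains M ∧ ∃ s : M.S,
      Q M s ∧ M.star.bisimType J n '' M.ext s = X}.Nonempty :=
    let ⟨M, hM, s, hs⟩ := hne
    ⟨_, M, hM, s, hs, rfl⟩
  obtain ⟨φ, hφ⟩ := SupportDefinable.exists_image_bisimType_subset.{u} hJ hF
  refine ⟨φ, fun M hM s => Iff.trans ?_ (hφ M.star (M.ext s)).symm⟩
  constructor
  · exact fun hs => ⟨_, ⟨M, hM, s, hs, rfl⟩, subset_rfl⟩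
  · rintro ⟨_, ⟨N, hN, t, ht, rfl⟩, hst⟩
    obtain ⟨r, hrt, hr⟩ := Set.subset_image_iff.1 hst
    obtain ⟨r, rfl⟩ := N.exists_ext_eq_of_subset hrt
    exact (hinv N M hN hM r s hr).1 (hdown N hN t r hrt ht)

theorem InqDefinable.bisimInvariant (h : Q.InqDefinable C) : Q.BisimInvariant C := by
  obtain ⟨φ, hφ⟩ := h
  intro M N hM hN s s' hs
  rw [hφ M hM, hφ N hN]
  exact hs.supports_iff φ

theorem InqDefinable.downwardClosed (h : Q.InqDefinable C) : Q.DownwardClosed C := by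
  obtain ⟨φ, hφ⟩ := h
  intro M hM s t hts hs
  exact (hφ M hM t).2 (((hφ M hM s).1 hs).mono hts)

theorem InqDefinable.nonemptyOver (h : Q.InqDefinable C) : Q.NonemptyOver C := by
  obtain ⟨φ, hφ⟩ := h
  obtain ⟨M, hfin, hfull⟩ := RelModel.exists_isFinite_and_locallyFull.{u, v} (I := I)
  have hM : C.Contains M := by
    cases C with
    | all => trivial
    | finite => exact hfin
    | locallyFull => exact hfull
    | finiteLocallyFull => exact ⟨hfin, hfull⟩
  obtain ⟨s⟩ := M.nonempty_S
  obtain ⟨t, ht⟩ := M.exists_ext_eq_of_subset (Set.empty_subset (M.ext s))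
  refine ⟨M, hM, t, (hφ M hM t).2 ?_⟩
  rw [ht]
  exact M.star.supports_empty φ

end StateProperty

end Inq

theorem mainTheorem3 {I : Type v} (C : Inq.ModelClass) :
    (∀ Q : Inq.WorldProperty.{u, v} I,
      Inq.WorldProperty.InqDefinable C Q ↔
        Inq.WorldProperty.FODefinable C Q ∧ Inq.WorldProperty.BisimInvariant C Q) ∧
    (∀ Q : Inq.StateProperty.{u, v} I,
      Inq.StateProperty.InqDefinable C Q ↔
        Inq.StateProperty.FODefinable C Q ∧ Inq.StateProperty.NonemptyOver C Q ∧
          Inq.StateProperty.DownwardClosed C Q ∧ Inq.StateProperty.BisimInvariant C Q) :=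
  ⟨fun _ =>
    ⟨fun h => ⟨h.foDefinable, h.bisimInvariant⟩, fun ⟨hFO, hB⟩ => hFO.inqDefinable hB⟩,
    fun _ =>
    ⟨fun h => ⟨h.foDefinable, h.nonemptyOver, h.downwardClosed, h.bisimInvariant⟩,
      fun ⟨hFO, hne, hdown, hB⟩ => hFO.inqDefinable hne hdown hB⟩⟩
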